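/- All graphs are finite and simple. A graph is $k$-connected if it has at least $k+1$ vertices and removing any set of at most $k-1$ vertices leaves a connected graph; a graph is $3$-polytopal if it is planar and $3$-connected. A graph satisfies $\mathcal P_n$ if it is $3$-polytopal, has at least one vertex of each degree $i$, $3\le i\le n$, and has minimal order (number of vertices) among the $3$-polytopal graphs with that property. We write $H\prec G$ if $H$ is isomorphic to a (not necessarily induced) subgraph of $G$. **Construction of $r_n$ ($n=14$ and $n\ge16$).** Splitting a triangle $\{a,b,c\}$ means adding a new vertex joined to $a,b,c$ only; if the new vertex is $d$ we write $d\to abc$. For $h\ge0$, $h$-splitting $\{a,b,c\}$ about $c$ means performing successively $c_1\to abc$, $c_2\to abc_1$, …, $c_h\to abc_{h-1}$. At each stage the graph carries four marked vertices. * $r_{14}$: start with a triangle $v_1v_2v_3$; for $i=4,\dots,9$ add $v_i\to v_{i-1}v_{i-2}v_{i-3}$; split every one of the $14$ triangles $v_1v_2v_3$, $v_7v_8v_9$, $v_iv_{i-1}v_{i-3}$, $v_iv_{i-2}v_{i-3}$ ($4\le i\le 9$), calling $v_{10},v_{11},v_{23}$ the vertices inserted in $v_1v_2v_4$, $v_2v_3v_5$,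 $v_7v_8v_9$; finally split $v_1v_4v_{10}$, $v_2v_5v_{11}$ and $v_3v_5v_{11}$. The marked vertices are $(v_7,v_8,v_9,v_{23})$. * Adding the piece $\mathrm{pc}_k$ ($k\ge1$) to a graph with marked vertices $(a,b,c,d)$: $u\to bcd$, $v\to cdu$, $w\to duv$; $e\to abd$, $f\to acd$; split $bdu,bcu,cuv,cdv,dvw,duw$; $x\to uvw$; then $4k$-split $\{a,b,e\}$ about $e$, $2$-split $\{a,d,f\}$ about $f$, and $(4k-1)$-split $\{c,d,f\}$ about $f$. The new marked vertices are $(u,v,w,x)$. * Adding $\mathrm{end}_{1;n}$: $v\to bcd$, $w\to cdv$; $e\to abd$, $f\to acd$, $g\to bcv$; split $bdv,cvw,cdw$; $x\to dvw$; then $\frac{n-11}2$-split $\{a,b,e\}$ about $e$, $\frac{n-13}2$-split $\{a,c,f\}$ about $f$, and $\frac{n-15}2$-split $\{b,c,g\}$ about $g$. The new marked vertices are $(d,v,w,x)$. * Adding $\mathrm{end}_{0;n}$: $w\to bcd$; $e\to abd$; split $acd,bdw,bcw,cdw$; $y\to abe$; split $aey$; then $(n-14)$-split $\{a,b,y\}$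 about $y$. If $n\equiv2\pmod 4$, $r_n$ is $r_{14}$ with $\mathrm{pc}_1,\dots,\mathrm{pc}_{(n-14)/4}$ added successively. If $n\equiv1$, $r_n$ is $r_{n-3}$ with $\mathrm{end}_{1;n}$ added; if $n\equiv0$ or $3$, $r_n$ is $r_{n-2}$ with $\mathrm{end}_{0;n}$ added. **Theorem.** For $n\ge3$, let $p(n)$ be the minimal number of vertices of a $3$-polytopal graph with at least one vertex of degree $i$ for every $3\le i\le n$ (such graphs exist). Then $$p(n)=\left\lceil\frac{n^2-11n+62}{4}\right\rceil\qquad\text{for all }n\ge14,$$ $p(n)=n+1$ for $3\le n\le7$, and $p(8)=10$, $p(9)=11$, $p(10)=14$, $p(11)=16$, $p(12)=19$, $p(13)=23$. Moreover, for $n=14$ and for every $n\ge16$ the graph $r_n$ constructed above satisfies $\mathcal P_n$, and for every $n\ge16$ $$r_n\succ\begin{cases}r_{n-2}&\text{if }n\equiv0\pmod4,\\ r_{n-3}&\text{if }n\equiv1\pmod4,\\ r_{n-4}&\text{if }n\equiv2\pmod4,\\ r_{n-5}&\text{if }n\equiv3\pmod4.\end{cases}$$ -/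

import Mathlib

open SimpleGraph

/-! ### Planar graphs, through rotation systems -/

/-- A rotation system on `G`: for every vertex `v` a cyclic order of the darts (oriented edges)
leaving `v`.  The permutation `next` sends a dart to the following one around its source, and the
darts with a given source form a single cycle of `next`.  Up to homeomorphism, the rotation systems
on `G` are the cellular embeddings of the components of `G` in oriented closed surfaces. -/
structure RotationSystem {V : Type*} (G : SimpleGraph V) where
  next : Equiv.Perm G.Dart
  next_fst : ∀ d : G.Dart, (next d).fst = d.fst
  sameCycle : ∀ d e : G.Dart, d.fst = e.fst → next.SameCycle d e

/-- Reversal of darts. -/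
def dartReverse {V : Type*} (G : SimpleGraph V) : Equiv.Perm G.Dart where
  toFun := Dart.symm
  invFun := Dart.symm
  left_inv := Dart.symm_symm
  right_inv := Dart.symm_symm

namespace RotationSystem

variable {V : Type*} {G : SimpleGraph V}

/-- The face permutation: run along the dart, then leave its end along the next dart there.
Its cycles are the boundary walks of the faces. -/
def face (R : RotationSystem G) : Equiv.Perm G.Dart := R.next * dartReverse G

/-- The number of faces, each component being embedded in a surface of its own: the cycles of the
face permutation, and one face for each isolated vertex (which carries no dart). -/
noncomputable def numFaces (R : RotationSystem G) : ℕ :=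
  Nat.card (Quotient (Equiv.Perm.SameCycle.setoid R.face)) +
    Nat.card {v : V // ∀ w, ¬ G.Adj v w}

end RotationSystem

/-- A finite graph is planar if it has an embedding in which every component lies in a sphere: a
rotation system whose surfaces all have genus `0`.  The surface of a component with `V` vertices,
`E` edges and `F` faces has genus `g ≥ 0` with `V - E + F = 2 - 2 g`, so all genera vanish exactly
when the Euler characteristics sum to twice the number of components. -/
def IsPlanar {V : Type*} [Finite V] (G : SimpleGraph V) : Prop :=
  ∃ R : RotationSystem G,
    Nat.card V + R.numFaces = Nat.card G.edgeSet + 2 * Nat.card G.ConnectedComponent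

/-! ### Polytopal graphs -/

/-- A graph of order at least `k + 1` is `k`-connected if removing any set of `k - 1` or fewer
vertices produces a connected graph. -/
def IsKConnected {V : Type*} [Finite V] (k : ℕ) (G : SimpleGraph V) : Prop :=
  k + 1 ≤ Nat.card V ∧
    ∀ S : Finset V, S.card < k → (G.induce {v : V | v ∉ S}).Connected

/-- `3`-polytopal graphs: planar and `3`-connected. -/
def IsPolytopal {V : Type*} [Finite V] (G : SimpleGraph V) : Prop :=
  IsPlanar G ∧ IsKConnected 3 G

/-- `G` has at least one vertex of degree `i`, for every `3 ≤ i ≤ n`. -/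
def HasDegreesUpTo {V : Type*} (n : ℕ) (G : SimpleGraph V) : Prop :=
  ∀ i : ℕ, 3 ≤ i → i ≤ n → ∃ v : V, (G.neighborSet v).ncard = i

/-- The orders of the `3`-polytopal graphs with a vertex of each degree `3, …, n`. -/
def polytopalOrders (n : ℕ) : Set ℕ :=
  {p | ∃ G : SimpleGraph (Fin p), IsPolytopal G ∧ HasDegreesUpTo n G}

/-- The property `𝒫ₙ`: `G` is a `3`-polytopal graph with a vertex of each degree `3, …, n`, and
it has minimal order among such graphs. -/
def PropertyP {V : Type*} [Finite V] (n : ℕ) (G : SimpleGraph V) : Prop :=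
  IsPolytopal G ∧ HasDegreesUpTo n G ∧ ∀ q ∈ polytopalOrders n, Nat.card V ≤ q

/-! ### The algorithm -/

/-- A finite graph as data: the vertices are `0, …, order - 1`, the edges are listed. -/
structure GraphData where
  order : ℕ
  edges : List (ℕ × ℕ)

namespace GraphData

/-- The graph that the data describe. -/
def toGraph (G : GraphData) : SimpleGraph (Fin G.order) :=
  SimpleGraph.fromRel fun i j => ((i : ℕ), (j : ℕ)) ∈ G.edges

/-- The triangle. -/
def triangle : GraphData := ⟨3, [(0, 1), (0, 2), (1, 2)]⟩

/-- Splitting the triangle `{a, b, c}`: add a vertex `d` (it gets the number `G.order`) and the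
edges `da`, `db`, `dc`. -/
def split (G : GraphData) (a b c : ℕ) : GraphData :=
  ⟨G.order + 1, (a, G.order) :: (b, G.order) :: (c, G.order) :: G.edges⟩

/-- Split the listed triangles one after the other. -/
def splitAll (G : GraphData) (l : List (ℕ × ℕ × ℕ)) : GraphData :=
  l.foldl (fun H t => H.split t.1 t.2.1 t.2.2) G

/-- `h`-splitting `{a, b, c}` about `c`: split `{a, b, c}` by `c₁`, then `{a, b, c₁}` by `c₂`, and
so on until `c_h` has been added. -/
def hSplit (G : GraphData) (a b c : ℕ) : ℕ → GraphData
  | 0 => G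
  | h + 1 => (G.split a b c).hSplit a b G.order h

end GraphData

/-- A stage of the algorithm: a graph with four marked vertices.  In the stages that occur,
`u, v, w` have degrees `10, 8, 6`, and `x` has degree `3` and is adjacent to `u, v, w`. -/
structure Stage where
  graph : GraphData
  u : ℕ
  v : ℕ
  w : ℕ
  x : ℕ

/-- The initial graph `r₁₄`.  The vertex `v_j` of the mathematical description is number `j - 1`.
After the triangle `v₁v₂v₃`, the vertices `v₄, …, v₉` are joined to their three predecessors;
then all `14` faces of the result are split, by `v₁₀, …, v₂₃`; then `{v₁, v₄, v₁₀}`,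
`{v₂, v₅, v₁₁}`, `{v₃, v₅, v₁₁}` are split.  The degrees of `v₁, …, v₁₁` are
`7, 9, 11, 13, 14, 12, 10, 8, 6, 4, 5`; the marked vertices are `v₇, v₈, v₉, v₂₃`. -/
def stage14 : Stage where
  graph := GraphData.triangle.splitAll
    [(2, 1, 0), (3, 2, 1), (4, 3, 2), (5, 4, 3), (6, 5, 4), (7, 6, 5),
      (0, 1, 3), (1, 2, 4),
      (0, 1, 2), (0, 2, 3), (1, 3, 4), (2, 3, 5), (2, 4, 5), (3, 4, 6), (3, 5, 6),
      (4, 5, 7), (4, 6, 7), (5, 6, 8), (5, 7, 8), (6, 7, 8),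
      (0, 3, 9), (1, 4, 10), (2, 4, 10)]
  u := 6
  v := 7
  w := 8
  x := 22

/-- Union with the `k`-th piece, the marked vertices being identified with `a, b, c, d` of the
piece.  The new vertices are `u, v, w` (numbers `m, m + 1, m + 2`), one vertex in each of the
triangles `abd, acd, bdu, bcu, cuv, cdv, dvw, duw, uvw` (numbers `m + 3, …, m + 11`), and those of
three `h`-splittings: with `e = m + 3` and `f = m + 4`, `{a, b, e}` is split `4 k` times about `e`,
`{a, d, f}` is split `2` times about `f`, and `{c, d, f}` is split `4 k - 1` times about `f`. -/
def Stage.addPiece (s : Stage) (k : ℕ) : Stage :=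
  let a := s.u
  let b := s.v
  let c := s.w
  let d := s.x
  let m := s.graph.order
  let G := s.graph.splitAll
    [(b, c, d), (c, d, m), (d, m, m + 1),
      (a, b, d), (a, c, d), (b, d, m), (b, c, m), (c, m, m + 1), (c, d, m + 1),
      (d, m + 1, m + 2), (d, m, m + 2), (m, m + 1, m + 2)]
  { graph := ((G.hSplit a b (m + 3) (4 * k)).hSplit a d (m + 4) 2).hSplit c d (m + 4) (4 * k - 1)
    u := m
    v := m + 1
    w := m + 2
    x := m + 11 }

/-- Union with the graph `end_{1;n}`, the marked vertices being identified with `a, b, c, d`.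
The new vertices are `v, w` (numbers `m, m + 1`), one vertex in each of the triangles
`abd, acd, bcv, bdv, cvw, cdw, dvw` (numbers `m + 2, …, m + 8`), and those of three `h`-splittings:
`{a, b, m + 2}` is split `(n - 11) / 2` times about `m + 2`, `{a, c, m + 3}` is split
`(n - 13) / 2` times about `m + 3`, and `{b, c, m + 4}` is split `(n - 15) / 2` times about
`m + 4`.  The vertices marked for a further union are `d, v, w` and the one in `dvw`. -/
def Stage.addEndOne (s : Stage) (n : ℕ) : Stage :=
  let a := s.u
  let b := s.v
  let c := s.w
  let d := s.x
  let m := s.graph.order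
  let G := s.graph.splitAll
    [(b, c, d), (c, d, m),
      (a, b, d), (a, c, d), (b, c, m), (b, d, m), (c, m, m + 1), (c, d, m + 1), (d, m, m + 1)]
  { graph := ((G.hSplit a b (m + 2) ((n - 11) / 2)).hSplit a c (m + 3) ((n - 13) / 2)).hSplit
      b c (m + 4) ((n - 15) / 2)
    u := d
    v := m
    w := m + 1
    x := m + 8 }

/-- Union with the graph `end_{0;n}`, the marked vertices being identified with `a, b, c, d`.
The new vertices are `w` (number `m`), one vertex in each of the triangles
`abd, acd, bdw, bcw, cdw` (numbers `m + 1, …, m + 5`); with `e = m + 1`, a vertex `y = m + 6` in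
`abe` and a vertex `m + 7` in `aey`; and those of an `(n - 14)`-splitting of `{a, b, y}` about
`y`. -/
def Stage.addEndZero (s : Stage) (n : ℕ) : GraphData :=
  let a := s.u
  let b := s.v
  let c := s.w
  let d := s.x
  let m := s.graph.order
  let G := s.graph.splitAll
    [(b, c, d), (a, b, d), (a, c, d), (b, d, m), (b, c, m), (c, d, m),
      (a, b, m + 1), (a, m + 1, m + 6)]
  G.hSplit a b (m + 6) (n - 14)

/-- `r₁₄` with the pieces `1, …, k` added. -/
def coreStage : ℕ → Stage
  | 0 => stage14
  | k + 1 => (coreStage k).addPiece (k + 1)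

/-- The output `r_n` of the algorithm, for `n = 14` and `n ≥ 16` (meaningless for other `n`). -/
def algorithmOutput (n : ℕ) : GraphData :=
  if n % 4 = 2 then (coreStage ((n - 14) / 4)).graph
  else if n % 4 = 1 then ((coreStage ((n - 17) / 4)).addEndOne n).graph
  else if n % 4 = 0 then (coreStage ((n - 16) / 4)).addEndZero n
  else ((coreStage ((n - 19) / 4)).addEndOne (n - 2)).addEndZero n

/-- The graph `r_n`. -/
def extremalGraph (n : ℕ) : SimpleGraph (Fin (algorithmOutput n).order) :=
  (algorithmOutput n).toGraph

/-!
The minimal order is bounded from below by two counts of edges, and the bounds are attained by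
stacked triangulations, that is, triangulations made from the tetrahedron by splitting faces.

*Lower bounds.* A planar graph has at most `3 k - 6` edges within a set of `k ≥ 3` vertices, and a
bipartite planar graph of order `p ≥ 3` has at most `2 p - 4` edges. Let `S` consist of one vertex
for each of the degrees `a, …, n`, and let `k = n + 1 - a ≥ 3` be its size. The sum of these
degrees counts the edges within `S` twice and the edges from `S` to the other vertices once, so
that it is at most `2 (3 k - 6) + (2 p - 4)` (`sum_Icc_add_sixteen_le`). With `a = 7` this is the
bound `p ≥ (n² - 11 n + 62) / 4`, and with `a = 6` it is the bound for `n = 8`. For `9 ≤ n ≤ 13` it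
suffices that the degrees are at least `3` and that their sum is at most `6 p - 12`
(`sum_sub_three_add_twelve_le`), and for `n ≤ 7` that a vertex of degree `n` has `n` neighbours.

Planarity is defined by a rotation system on the whole graph, so the inequality of Euler is needed
for subgraphs `H` (`RotationSystem.euler_subgraph`). The faces of `H` are represented on the darts
of the whole graph, by reversing only the darts of `H` in the definition of the face permutation.
Then the removal of an edge multiplies the permutation by a transposition, which changes the number
of cycles by one, and increases it if the edge is a bridge. So the genus cannot grow. The bounds for
the number of edges follow since a face with at most two sides fills a whole component of `H`.

*Upper bounds.* A triangulation is described by the function which sends a dart to the third vertex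
of the face on its left (`GraphData.IsTriangulation`). Splitting a face changes this function in
nine places and keeps the graph `3`-connected (`GraphData.IsTriangulation.split`). That the
triangles in the construction are faces when they are split, and how the degrees grow, is computed
with labels for the vertices near the marked ones (`GraphData.HasFaces.splitAll`). The invariant
`Stage.IsGood` says that the unmarked vertices have all degrees up to `n` other than `6, 8, 10`,
which are the degrees of three marked vertices; each step preserves it with a larger `n`. The orders
are polynomials in the number of pieces, and agree with the lower bound.
-/

/-! ### Counting classes of equivalence relations and cycles of permutations -/

/-- Merging two classes of an equivalence relation lowers the number of classes by at most one. -/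
theorem card_quotient_le_add_one {α : Type*} [Finite α] (r s : Setoid α) (x y : α)
    (h : ∀ z w, s z w → r z w ∨ (r z x ∧ r y w) ∨ (r z y ∧ r x w)) :
    Nat.card (Quotient r) ≤ Nat.card (Quotient s) + 1 := by
  classical
  rw [← Finite.card_option]
  let f : Quotient r → Option (Quotient s) := fun q =>
    if q = Quotient.mk r y then none else some (Quotient.mk s q.out)
  refine Nat.card_le_card_of_injective f fun q q' hqq' => ?_
  by_cases h1 : q = Quotient.mk r y <;> by_cases h2 : q' = Quotient.mk r y
  · rw [h1, h2]
  · simp [f, h1, h2] at hqq'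
  · simp [f, h1, h2] at hqq'
  · simp only [f, h1, h2, if_false, Option.some.injEq] at hqq'
    rcases h _ _ (Quotient.exact hqq') with h3 | ⟨-, h3⟩ | ⟨h3, -⟩
    · rw [← q.out_eq, ← q'.out_eq]
      exact Quotient.sound h3
    · exact absurd (by rw [← q'.out_eq]; exact (Quotient.sound h3).symm) h2
    · exact absurd (by rw [← q.out_eq]; exact Quotient.sound h3) h1

namespace Equiv.Perm

variable {α : Type*}

/-- The number of cycles of a permutation, fixed points included. -/
noncomputable def numCycles (f : Perm α) : ℕ := Nat.card (Quotient (SameCycle.setoid f))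

/-- A relation that is reflexive and transitive and holds along each step of a permutation holds
along its cycles. -/
theorem SameCycle.induct [Finite α] {f : Perm α} {P : α → α → Prop} (refl : ∀ z, P z z)
    (trans : ∀ a b c, P a b → P b c → P a c) (step : ∀ z, P z (f z)) {z w : α}
    (h : f.SameCycle z w) : P z w := by
  obtain ⟨n, rfl⟩ := h.exists_nat_pow_eq
  induction n with
  | zero => exact refl z
  | succ n ih =>
    rw [pow_succ', mul_apply]
    exact trans _ _ _ (ih ((sameCycle_pow_right).2 (SameCycle.refl f z))) (step _)

theorem SameCycle.apply_self (f : Perm α) (z : α) : f.SameCycle z (f z) :=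
  (sameCycle_apply_right).2 (SameCycle.refl f z)

theorem numCycles_le_mul_swap_add_one [Finite α] [DecidableEq α] (f : Perm α) (x y : α) :
    f.numCycles ≤ (f * swap x y).numCycles + 1 := by
  refine card_quotient_le_add_one _ _ x y fun z w h => ?_
  change f.SameCycle z w ∨ (f.SameCycle z x ∧ f.SameCycle y w) ∨
    (f.SameCycle z y ∧ f.SameCycle x w)
  refine SameCycle.induct (f := f * swap x y) (P := fun z w => f.SameCycle z w ∨
    (f.SameCycle z x ∧ f.SameCycle y w) ∨ (f.SameCycle z y ∧ f.SameCycle x w))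
    (fun z => Or.inl (SameCycle.refl f z)) ?_ ?_ h
  · rintro a b c (h1 | ⟨h1, h2⟩ | ⟨h1, h2⟩) (h3 | ⟨h3, h4⟩ | ⟨h3, h4⟩)
    · exact Or.inl (h1.trans h3)
    · exact Or.inr (Or.inl ⟨h1.trans h3, h4⟩)
    · exact Or.inr (Or.inr ⟨h1.trans h3, h4⟩)
    · exact Or.inr (Or.inl ⟨h1, h2.trans h3⟩)
    · exact Or.inl (h1.trans ((h2.trans h3).symm.trans h4))
    · exact Or.inl (h1.trans h4)
    · exact Or.inr (Or.inr ⟨h1, h2.trans h3⟩)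
    · exact Or.inl (h1.trans h4)
    · exact Or.inl (h1.trans ((h2.trans h3).symm.trans h4))
  · intro z
    by_cases hx : z = x
    · subst hx
      refine Or.inr (Or.inl ⟨SameCycle.refl f z, ?_⟩)
      simpa using SameCycle.apply_self f y
    by_cases hy : z = y
    · subst hy
      refine Or.inr (Or.inr ⟨SameCycle.refl f z, ?_⟩)
      simpa using SameCycle.apply_self f x
    · left
      simpa [swap_apply_of_ne_of_ne hx hy] using SameCycle.apply_self f z

/-- Multiplication by a transposition of two points in different cycles makes one cycle of the
two. -/
theorem sameCycle_mul_swap [Finite α] [DecidableEq α] {f : Perm α} {x y : α}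
    (h : ¬ f.SameCycle x y) : (f * swap x y).SameCycle x y := by
  by_contra hg
  have key : ∀ m : ℕ, (f * swap x y).SameCycle x ((f ^ (m + 1)) y) := by
    intro m
    induction m with
    | zero => simpa using SameCycle.apply_self (f * swap x y) x
    | succ m ih =>
      have hx : (f ^ (m + 1)) y ≠ x := fun h' =>
        h (by rw [← h', sameCycle_pow_left])
      have hy : (f ^ (m + 1)) y ≠ y := fun h' => hg (by rwa [h'] at ih)
      have := ih.trans (SameCycle.apply_self _ _)
      rwa [mul_apply, swap_apply_of_ne_of_ne hx hy, ← mul_apply, ← pow_succ'] at this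
  have := key (orderOf f - 1)
  rw [Nat.sub_add_cancel (orderOf_pos f), pow_orderOf_eq_one] at this
  exact hg this

theorem numCycles_mul_swap_add_one_le [Finite α] [DecidableEq α] {f : Perm α} {x y : α}
    (h : ¬ f.SameCycle x y) : (f * swap x y).numCycles + 1 ≤ f.numCycles := by
  classical
  have := Fintype.ofFinite α
  have hg := sameCycle_mul_swap h
  have hle : ∀ z w, f.SameCycle z w → (f * swap x y).SameCycle z w := by
    intro z w hzw
    refine SameCycle.induct (f := f) (SameCycle.refl _) (fun _ _ _ => SameCycle.trans) ?_ hzw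
    intro z
    have hz := SameCycle.apply_self (f * swap x y) (swap x y z)
    rw [mul_apply, swap_apply_self] at hz
    refine SameCycle.trans ?_ hz
    by_cases hx : z = x
    · subst hx; simpa using hg
    by_cases hy : z = y
    · subst hy; simpa using hg.symm
    · rw [swap_apply_of_ne_of_ne hx hy]
  unfold numCycles
  rw [Nat.card_eq_fintype_card, Nat.card_eq_fintype_card]
  let F : Quotient (SameCycle.setoid f) → Quotient (SameCycle.setoid (f * swap x y)) :=
    Quotient.map' id hle
  refine Fintype.card_lt_of_surjective_not_injective F ?_ fun hinj => h ?_
  · rintro ⟨z⟩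
    exact ⟨Quotient.mk _ z, rfl⟩
  · have : F (Quotient.mk _ x) = F (Quotient.mk _ y) := Quotient.sound hg
    exact Quotient.exact (hinj this)

end Equiv.Perm

/-! ### Euler's formula for the subgraphs of a planar graph -/

instance {V : Type*} [Finite V] (G : SimpleGraph V) : Finite G.Dart :=
  Finite.of_injective _ Dart.toProd_injective

namespace RotationSystem

variable {V : Type*} {G : SimpleGraph V}

open Classical in
/-- Reversal of the darts of a subgraph `H`; the other darts are fixed. -/
noncomputable def restrictedReverse (G H : SimpleGraph V) : Equiv.Perm G.Dart :=
  Function.Involutive.toPerm (fun d => if H.Adj d.fst d.snd then d.symm else d) fun d => by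
    by_cases h : H.Adj d.fst d.snd
    · simp [h, h.symm]
    · simp [h]

/-- The face permutation of the embedding of a subgraph `H` on all darts of `G`: the darts outside
`H` are not run along, but passed when turning around a vertex.  So an isolated vertex of `H` which
carries a dart of `G` contributes one cycle. -/
noncomputable def restrictedFace (R : RotationSystem G) (H : SimpleGraph V) :
    Equiv.Perm G.Dart := R.next * restrictedReverse G H

theorem restrictedFace_of_adj (R : RotationSystem G) {H : SimpleGraph V} {d : G.Dart}
    (h : H.Adj d.fst d.snd) : R.restrictedFace H d = R.next d.symm :=
  congrArg R.next (if_pos h)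

theorem restrictedFace_of_not_adj (R : RotationSystem G) {H : SimpleGraph V} {d : G.Dart}
    (h : ¬ H.Adj d.fst d.snd) : R.restrictedFace H d = R.next d :=
  congrArg R.next (if_neg h)

theorem restrictedFace_self (R : RotationSystem G) : R.restrictedFace G = R.face := by
  ext1 d
  rw [R.restrictedFace_of_adj d.adj]
  rfl

theorem restrictedFace_sup_edge [DecidableEq G.Dart] (R : RotationSystem G) {H : SimpleGraph V}
    (d : G.Dart) (hd : ¬ H.Adj d.fst d.snd) :
    R.restrictedFace (H ⊔ edge d.fst d.snd) = R.restrictedFace H * Equiv.swap d d.symm := by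
  ext1 e
  have hne : d.fst ≠ d.snd := d.adj.ne
  rw [Equiv.Perm.mul_apply]
  by_cases h1 : e = d
  · subst h1
    rw [Equiv.swap_apply_left, R.restrictedFace_of_adj (by simp [edge_adj, hne]),
      R.restrictedFace_of_not_adj]
    exact fun h => hd h.symm
  by_cases h2 : e = d.symm
  · subst h2
    rw [Equiv.swap_apply_right, R.restrictedFace_of_adj (by simp [edge_adj, hne, hne.symm]),
      R.restrictedFace_of_not_adj hd, Dart.symm_symm]
  rw [Equiv.swap_apply_of_ne_of_ne h1 h2]
  have h3 : (H ⊔ edge d.fst d.snd).Adj e.fst e.snd ↔ H.Adj e.fst e.snd := by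
    simp only [sup_adj, edge_adj, or_iff_left_iff_imp]
    rintro ⟨⟨h, h'⟩ | ⟨h, h'⟩, -⟩
    · exact absurd (Dart.ext _ _ (Prod.ext h h')) h1
    · exact absurd (Dart.ext _ _ (Prod.ext h h')) h2
  by_cases h4 : H.Adj e.fst e.snd
  · rw [R.restrictedFace_of_adj h4, R.restrictedFace_of_adj (h3.2 h4)]
  · rw [R.restrictedFace_of_not_adj h4, R.restrictedFace_of_not_adj (mt h3.1 h4)]

theorem reachable_restrictedFace (R : RotationSystem G) (H : SimpleGraph V) (d : G.Dart) :
    H.Reachable d.fst (R.restrictedFace H d).fst := by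
  by_cases h : H.Adj d.fst d.snd
  · rw [R.restrictedFace_of_adj h, R.next_fst]
    exact h.reachable
  · rw [R.restrictedFace_of_not_adj h, R.next_fst]

theorem reachable_of_sameCycle [Finite V] (R : RotationSystem G) (H : SimpleGraph V)
    {d e : G.Dart} (h : (R.restrictedFace H).SameCycle d e) : H.Reachable d.fst e.fst :=
  h.induct (P := fun d e : G.Dart => H.Reachable d.fst e.fst) (fun _ => Reachable.refl _)
    (fun _ _ _ => Reachable.trans) (R.reachable_restrictedFace H)

end RotationSystem

theorem reachable_sup_edge {V : Type*} {H : SimpleGraph V} {x y z w : V}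
    (h : (H ⊔ edge x y).Reachable z w) :
    H.Reachable z w ∨ (H.Reachable z x ∧ H.Reachable y w) ∨
      (H.Reachable z y ∧ H.Reachable x w) := by
  rw [reachable_iff_reflTransGen] at h
  induction h with
  | refl => exact Or.inl (Reachable.refl _)
  | @tail b c _ h ih =>
    rw [sup_adj, edge_adj] at h
    rcases h with h | ⟨⟨rfl, rfl⟩ | ⟨rfl, rfl⟩, -⟩
    · have h := h.reachable
      rcases ih with h1 | ⟨h1, h2⟩ | ⟨h1, h2⟩
      · exact Or.inl (h1.trans h)
      · exact Or.inr (Or.inl ⟨h1, h2.trans h⟩)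
      · exact Or.inr (Or.inr ⟨h1, h2.trans h⟩)
    · rcases ih with h1 | ⟨h1, h2⟩ | ⟨h1, h2⟩
      · exact Or.inr (Or.inl ⟨h1, Reachable.refl _⟩)
      · exact Or.inl ((h1.trans h2.symm).trans (Reachable.refl _))
      · exact Or.inl h1
    · rcases ih with h1 | ⟨h1, h2⟩ | ⟨h1, h2⟩
      · exact Or.inr (Or.inr ⟨h1, Reachable.refl _⟩)
      · exact Or.inl h1
      · exact Or.inl (h1.trans h2.symm)

theorem card_connectedComponent_le_sup_edge {V : Type*} [Finite V] (H : SimpleGraph V) (x y : V) :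
    Nat.card H.ConnectedComponent ≤ Nat.card (H ⊔ edge x y).ConnectedComponent + 1 :=
  card_quotient_le_add_one H.reachableSetoid (H ⊔ edge x y).reachableSetoid x y
    fun _ _ => reachable_sup_edge

theorem card_connectedComponent_le_of_reachable {V : Type*} [Finite V] {H : SimpleGraph V}
    {x y : V} (h : H.Reachable x y) :
    Nat.card H.ConnectedComponent ≤ Nat.card (H ⊔ edge x y).ConnectedComponent := by
  refine Nat.card_le_card_of_injective
    (ConnectedComponent.map (Hom.ofLE (le_sup_left : H ≤ H ⊔ edge x y))) ?_
  rintro ⟨z⟩ ⟨w⟩ hzw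
  refine ConnectedComponent.sound ?_
  rcases reachable_sup_edge (ConnectedComponent.exact hzw) with h1 | ⟨h1, h2⟩ | ⟨h1, h2⟩
  · exact h1
  · exact h1.trans (h.trans h2)
  · exact h1.trans (h.symm.trans h2)

/-- The genus does not increase when edges are removed, so it stays `0` for the subgraphs of a
planar graph.  Adding back an edge multiplies the face permutation by a transposition, so that it
merges two cycles (necessarily when the edge joins two components) or splits one. -/
theorem RotationSystem.euler_subgraph {V : Type*} [Finite V] {G : SimpleGraph V}
    (R : RotationSystem G)
    (hR : Nat.card V + R.numFaces = Nat.card G.edgeSet + 2 * Nat.card G.ConnectedComponent)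
    (H : SimpleGraph V) (hH : H ≤ G) :
    Nat.card H.edgeSet + 2 * Nat.card H.ConnectedComponent ≤
      Nat.card V + ((R.restrictedFace H).numCycles + Nat.card {v : V // ∀ w, ¬ G.Adj v w}) := by
  classical
  have := Fintype.ofFinite V
  induction H using WellFoundedGT.induction with
  | ind H ih =>
  rcases hH.eq_or_lt with rfl | hlt
  · rw [R.restrictedFace_self]
    exact hR.ge
  obtain ⟨x, y, hxy, hnxy⟩ : ∃ x y, G.Adj x y ∧ ¬ H.Adj x y := by
    by_contra! hcon
    exact hlt.not_ge fun x y => hcon x y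
  let d : G.Dart := ⟨(x, y), hxy⟩
  have ih' := ih (H ⊔ edge x y) (lt_sup_edge _ _ _ hxy.ne hnxy)
    (sup_le hH ((edge_le_iff _).2 (Or.inr hxy)))
  have hcard : Nat.card (H ⊔ edge x y).edgeSet = Nat.card H.edgeSet + 1 := by
    rw [Nat.card_eq_fintype_card, Nat.card_eq_fintype_card, ← edgeFinset_card, ← edgeFinset_card]
    exact card_edgeFinset_sup_edge _ hnxy hxy.ne
  have hface := R.restrictedFace_sup_edge d hnxy
  change R.restrictedFace (H ⊔ edge x y) = _ at hface
  rw [hcard, hface] at ih'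
  by_cases hr : H.Reachable x y
  · have h1 := card_connectedComponent_le_of_reachable hr
    have h2 := Equiv.Perm.numCycles_le_mul_swap_add_one (R.restrictedFace H * Equiv.swap d d.symm)
      d d.symm
    rw [mul_assoc, Equiv.swap_mul_self, mul_one] at h2
    omega
  · have h1 := card_connectedComponent_le_sup_edge H x y
    have h2 := Equiv.Perm.numCycles_mul_swap_add_one_le (f := R.restrictedFace H) (x := d)
      (y := d.symm) fun h => hr (R.reachable_of_sameCycle H h)
    omega

/-! ### Lengths of faces and bounds for the number of edges -/

namespace RotationSystem

variable {V : Type*} {G : SimpleGraph V} (R : RotationSystem G) (H : SimpleGraph V)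

/-- The darts of `H` in the cycle of `e`, that is, the boundary walk of a face of `H`. -/
def sides (e : G.Dart) : Set G.Dart :=
  {d | (R.restrictedFace H).SameCycle e d ∧ H.Adj d.fst d.snd}

variable {R H}

theorem sides_eq_of_sameCycle {e e' : G.Dart} (h : (R.restrictedFace H).SameCycle e e') :
    R.sides H e = R.sides H e' :=
  Set.ext fun _ => and_congr_left fun _ => ⟨h.symm.trans, h.trans⟩

/-- A face that is entered just after the dart `g`, and that meets no other dart of `H` at the
source of `g`, turns all the way around this vertex. -/
theorem sameCycle_of_fst_eq [Finite V] {g : G.Dart}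
    (h₁ : (R.restrictedFace H).SameCycle g (R.next g))
    (h₂ : ∀ e ∈ R.sides H g, e.fst = g.fst → e = g) {e : G.Dart} (he : e.fst = g.fst) :
    (R.restrictedFace H).SameCycle g e := by
  obtain ⟨m, rfl⟩ := (R.sameCycle g e he.symm).exists_nat_pow_eq
  clear he
  induction m with
  | zero => exact Equiv.Perm.SameCycle.refl _ _
  | succ m ih =>
    have hfst : ((R.next ^ m) g).fst = g.fst := by
      clear ih
      induction m with
      | zero => rfl
      | succ m ih => rw [pow_succ', Equiv.Perm.mul_apply, R.next_fst, ih]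
    rw [pow_succ', Equiv.Perm.mul_apply]
    by_cases hadj : H.Adj ((R.next ^ m) g).fst ((R.next ^ m) g).snd
    · rwa [h₂ _ ⟨ih, hadj⟩ hfst]
    · have := ih.trans (Equiv.Perm.SameCycle.apply_self _ _)
      rwa [R.restrictedFace_of_not_adj hadj] at this

theorem exists_side [Finite V] {e f : G.Dart} (hf : f.fst = e.fst) (hadj : H.Adj f.fst f.snd) :
    ∃ d ∈ R.sides H e, d.fst = e.fst := by
  by_contra! hcon
  have hfe : (R.restrictedFace H).SameCycle e f := by
    refine sameCycle_of_fst_eq ?_ (fun d hd h => absurd h (hcon d hd)) hf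
    have := Equiv.Perm.SameCycle.apply_self (R.restrictedFace H) e
    rwa [R.restrictedFace_of_not_adj fun h => hcon e ⟨.refl _ _, h⟩ rfl] at this
  exact hcon f ⟨hfe, hadj⟩ hf

theorem sameCycle_next_symm {d : G.Dart} (h : H.Adj d.fst d.snd) :
    (R.restrictedFace H).SameCycle d (R.next d.symm) := by
  rw [← R.restrictedFace_of_adj h]
  exact Equiv.Perm.SameCycle.apply_self _ _

/-- After the side `d`, a face has a side leaving the end of `d`. -/
theorem exists_side_succ [Finite V] {e d : G.Dart} (hd : d ∈ R.sides H e) :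
    ∃ d' ∈ R.sides H e, d'.fst = d.snd := by
  obtain ⟨d', hd', h⟩ := exists_side (R := R) (e := R.next d.symm) (f := d.symm)
    (by rw [R.next_fst]) hd.2.symm
  rw [R.next_fst] at h
  exact ⟨d', by rwa [sides_eq_of_sameCycle (hd.1.trans (sameCycle_next_symm hd.2))], h⟩

theorem ncard_sides_ne_one [Finite V] (e : G.Dart) : (R.sides H e).ncard ≠ 1 := by
  intro h
  obtain ⟨d, hd⟩ := Set.ncard_eq_one.1 h
  obtain ⟨d', hd', h'⟩ := exists_side_succ (hd ▸ Set.mem_singleton d : d ∈ R.sides H e)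
  rw [hd, Set.mem_singleton_iff] at hd'
  exact d.adj.ne (by rw [← h', hd'])

/-- A face without sides turns around an isolated vertex of `H`, and a face with two sides goes
around a component of `H` with a single edge. So both contain all darts of a component. -/
theorem sameCycle_of_ncard_sides_le_two [Finite V] (hH : H ≤ G) {e e' : G.Dart}
    (h : (R.sides H e).ncard ≤ 2) (hee' : H.Reachable e.fst e'.fst) :
    (R.restrictedFace H).SameCycle e e' := by
  rcases (R.sides H e).eq_empty_or_nonempty with hempty | ⟨d, hd⟩
  · have hiso : ∀ w, ¬ H.Adj e.fst w := by
      intro w hw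
      obtain ⟨d, hd, -⟩ := exists_side (R := R) (e := e) (f := ⟨(e.fst, w), hH hw⟩) rfl hw
      rwa [hempty] at hd
    have heq : e'.fst = e.fst := by
      rw [reachable_iff_reflTransGen] at hee'
      rcases hee'.cases_head with h | ⟨c, hc, -⟩
      · exact h.symm
      · exact absurd hc (hiso c)
    refine sameCycle_of_fst_eq ?_ (fun d hd => by rw [hempty] at hd; exact hd.elim) heq
    have := Equiv.Perm.SameCycle.apply_self (R.restrictedFace H) e
    rwa [R.restrictedFace_of_not_adj (hiso _)] at this
  · obtain ⟨d', hd', h'⟩ := exists_side_succ hd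
    have hne : d ≠ d' := fun h => d.adj.ne (by rw [← h', h])
    have hS : {d, d'} = R.sides H e := by
      refine Set.eq_of_subset_of_ncard_le (Set.insert_subset hd (Set.singleton_subset_iff.2 hd'))
        ?_ (Set.toFinite _)
      rwa [Set.ncard_pair hne]
    have hsymm : d' = d.symm := by
      obtain ⟨d'', hd'', h''⟩ := exists_side_succ hd'
      rw [← hS] at hd''
      rcases hd'' with rfl | rfl
      · exact Dart.ext _ _ (Prod.ext h' h''.symm)
      · exact absurd h'' d''.adj.ne
    subst hsymm
    have h1 : ∀ f : G.Dart, f.fst = d.fst → (R.restrictedFace H).SameCycle e f := by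
      intro f hf
      refine hd.1.trans (sameCycle_of_fst_eq ?_ ?_ hf)
      · have := sameCycle_next_symm (R := R) hd'.2
        rw [Dart.symm_symm] at this
        exact hd.1.symm.trans (hd'.1.trans this)
      · intro f' hf' hff'
        rw [← sides_eq_of_sameCycle hd.1, ← hS] at hf'
        rcases hf' with rfl | rfl
        · rfl
        · exact absurd hff' d.adj.ne'
    have h2 : ∀ f : G.Dart, f.fst = d.snd → (R.restrictedFace H).SameCycle e f := by
      intro f hf
      refine hd'.1.trans (sameCycle_of_fst_eq ?_ ?_ hf)
      · exact hd'.1.symm.trans (hd.1.trans (sameCycle_next_symm hd.2))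
      · intro f' hf' hff'
        rw [← sides_eq_of_sameCycle hd'.1, ← hS] at hf'
        rcases hf' with rfl | rfl
        · exact absurd hff' f'.adj.ne
        · rfl
    have h3 : e'.fst = d.fst ∨ e'.fst = d.snd := by
      have := (reachable_of_sameCycle R H hd.1).symm.trans hee'
      rw [reachable_iff_reflTransGen] at this
      generalize e'.fst = z at this
      induction this with
      | refl => exact Or.inl rfl
      | @tail b c _ hbc ih =>
        have hmem : (⟨(b, c), hH hbc⟩ : G.Dart) ∈ R.sides H e :=
          ⟨ih.elim (fun h => h1 ⟨(b, c), hH hbc⟩ h) fun h => h2 ⟨(b, c), hH hbc⟩ h, hbc⟩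
        rw [← hS] at hmem
        rcases hmem with h | h
        · exact Or.inr (congrArg (fun x : G.Dart => x.snd) h)
        · exact Or.inl (congrArg (fun x : G.Dart => x.snd) h)
    exact h3.elim (h1 _) (h2 _)

/-- The boundary walks of the faces of a bipartite graph alternate between the two sides. -/
theorem even_ncard_sides [Finite V] {s : Set V}
    (hs : ∀ u v, H.Adj u v → (u ∈ s ↔ v ∉ s)) (e : G.Dart) : Even (R.sides H e).ncard := by
  classical
  have := Fintype.ofFinite G.Dart
  set f := R.restrictedFace H with hf
  let A : Finset G.Dart := Finset.univ.filter fun d => f.SameCycle e d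
  have hfst : ∀ d, (f d).fst ∈ s ↔ (d.fst ∈ s ↔ ¬ H.Adj d.fst d.snd) := by
    intro d
    by_cases h : H.Adj d.fst d.snd
    · rw [hf, R.restrictedFace_of_adj h, R.next_fst]
      have := hs _ _ h
      change d.snd ∈ s ↔ _
      tauto
    · rw [hf, R.restrictedFace_of_not_adj h, R.next_fst]
      tauto
  have h1 : (A.filter fun d => (f d).fst ∈ s).card = (A.filter fun d => d.fst ∈ s).card := by
    refine Finset.card_bij (fun d _ => f d) ?_ (fun _ _ _ _ h => f.injective h) ?_
    · intro d hd
      simp only [A, Finset.mem_filter, Finset.mem_univ, true_and] at hd ⊢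
      exact ⟨hd.1.trans (.apply_self _ _), hd.2⟩
    · intro d hd
      simp only [A, Finset.mem_filter, Finset.mem_univ, true_and] at hd ⊢
      refine ⟨f.symm d, ⟨?_, by simpa using hd.2⟩, by simp⟩
      have := Equiv.Perm.SameCycle.apply_self f (f.symm d)
      rw [Equiv.apply_symm_apply] at this
      exact hd.1.trans this.symm
  have h2 := Finset.card_filter_add_card_filter_not (s := A.filter fun d => (f d).fst ∈ s)
    (fun d => H.Adj d.fst d.snd)
  have h3 := Finset.card_filter_add_card_filter_not (s := A.filter fun d => d.fst ∈ s)
    (fun d => H.Adj d.fst d.snd)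
  have h4 := Finset.card_filter_add_card_filter_not
    (s := A.filter fun d => H.Adj d.fst d.snd) (fun d => d.fst ∈ s)
  have h5 : (R.sides H e).ncard = (A.filter fun d => H.Adj d.fst d.snd).card := by
    rw [← Set.ncard_coe_finset]
    congr 1
    ext d
    simp [sides, A, hf]
  simp only [Finset.filter_filter] at h2 h3 h4
  have h6 : (A.filter fun d => (f d).fst ∈ s ∧ ¬ H.Adj d.fst d.snd) =
      A.filter fun d => d.fst ∈ s ∧ ¬ H.Adj d.fst d.snd := by
    ext d; simp only [Finset.mem_filter, hfst]; tauto
  have h7 : (A.filter fun d => (f d).fst ∈ s ∧ H.Adj d.fst d.snd) =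
      A.filter fun d => H.Adj d.fst d.snd ∧ d.fst ∉ s := by
    ext d; simp only [Finset.mem_filter, hfst]; tauto
  have h8 : (A.filter fun d => d.fst ∈ s ∧ H.Adj d.fst d.snd) =
      A.filter fun d => H.Adj d.fst d.snd ∧ d.fst ∈ s := by
    ext d; simp only [Finset.mem_filter]; tauto
  rw [h6, h7] at h2
  rw [h8] at h3
  exact ⟨(A.filter fun d => H.Adj d.fst d.snd ∧ d.fst ∈ s).card, by omega⟩

variable (R H) in
/-- The number of sides of a face of `H`. -/
noncomputable def faceLength [Finite V] :
    Quotient (Equiv.Perm.SameCycle.setoid (R.restrictedFace H)) → ℕ :=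
  Quotient.lift (fun e => (R.sides H e).ncard) fun _ _ h =>
    congrArg Set.ncard (sides_eq_of_sameCycle h)

variable (R H) in
/-- The component of `H` to which a face belongs. -/
noncomputable def faceComponent [Finite V] :
    Quotient (Equiv.Perm.SameCycle.setoid (R.restrictedFace H)) → H.ConnectedComponent :=
  Quotient.lift (fun e => H.connectedComponentMk e.fst) fun _ _ h =>
    ConnectedComponent.sound (R.reachable_of_sameCycle H h)

theorem eq_of_faceComponent_eq [Finite V] (hH : H ≤ G) {q q'}
    (hq : R.faceLength H q ≤ 2) (h : R.faceComponent H q = R.faceComponent H q') : q = q' := by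
  induction q using Quotient.inductionOn
  induction q' using Quotient.inductionOn
  exact Quotient.sound (sameCycle_of_ncard_sides_le_two hH hq (ConnectedComponent.exact h))

theorem sum_faceLength [Finite V] (hH : H ≤ G)
    [Fintype (Quotient (Equiv.Perm.SameCycle.setoid (R.restrictedFace H)))] :
    ∑ q, R.faceLength H q = 2 * Nat.card H.edgeSet := by
  classical
  have := Fintype.ofFinite V
  have := Fintype.ofFinite G.Dart
  have h1 := Finset.card_eq_sum_card_fiberwise
    (s := Finset.univ.filter fun d : G.Dart => H.Adj d.fst d.snd) (t := Finset.univ)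
    (f := fun d => Quotient.mk (Equiv.Perm.SameCycle.setoid (R.restrictedFace H)) d)
    (fun _ _ => Finset.mem_coe.2 (Finset.mem_univ _))
  have h2 : (Finset.univ.filter fun d : G.Dart => H.Adj d.fst d.snd).card =
      2 * Nat.card H.edgeSet := by
    rw [Nat.card_eq_fintype_card, ← edgeFinset_card, ← H.dart_card_eq_twice_card_edges]
    symm
    refine Finset.card_bij (fun (d : H.Dart) _ => (⟨d.toProd, hH d.adj⟩ : G.Dart)) ?_ ?_ ?_
    · intro d _
      simp
    · intro d _ d' _ h
      exact Dart.ext _ _ (congrArg (fun x : G.Dart => x.toProd) h)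
    · intro d hd
      exact ⟨⟨d.toProd, (Finset.mem_filter.1 hd).2⟩, Finset.mem_univ _, rfl⟩
  rw [← h2, h1]
  refine Finset.sum_congr rfl fun q _ => ?_
  induction q using Quotient.inductionOn with
  | h e =>
  change (R.sides H e).ncard = _
  rw [← Set.ncard_coe_finset]
  congr 1
  ext d
  simp only [sides, Set.mem_ofPred_eq, Finset.coe_filter, Finset.mem_filter, Finset.mem_univ,
    true_and, Quotient.eq]
  exact ⟨fun h => ⟨h.2, h.1.symm⟩, fun h => ⟨h.2.symm, h.1⟩⟩

end RotationSystem

/-- Euler's bound for a subgraph `H` whose faces have at least `m` sides, apart from those which go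
around an isolated vertex or a component with one edge. The first alternative is the case where
there are no other faces. -/
theorem card_edgeSet_le_of_faceLength {V : Type*} [Finite V] {G H : SimpleGraph V}
    (R : RotationSystem G) (hR : Nat.card V + R.numFaces =
      Nat.card G.edgeSet + 2 * Nat.card G.ConnectedComponent)
    (hiso : ∀ v, ∃ w, G.Adj v w) (hH : H ≤ G) {m : ℕ} (hm : 2 < m)
    (hlen : ∀ q, R.faceLength H q = 0 ∨ R.faceLength H q = 2 ∨ m ≤ R.faceLength H q) :
    Nat.card H.edgeSet + Nat.card H.ConnectedComponent ≤ Nat.card V ∨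
    (m - 2) * Nat.card H.edgeSet + m * (Nat.card H.ConnectedComponent + 1) ≤ m * Nat.card V := by
  classical
  have := Fintype.ofFinite V
  have := Fintype.ofFinite (Quotient (Equiv.Perm.SameCycle.setoid (R.restrictedFace H)))
  have := Fintype.ofFinite H.ConnectedComponent
  have heuler := R.euler_subgraph hR H hH
  have hempty : IsEmpty {v : V // ∀ w, ¬ G.Adj v w} := by
    refine ⟨fun v => ?_⟩
    obtain ⟨w, hw⟩ := hiso v
    exact v.2 w hw
  have hF : (R.restrictedFace H).numCycles =
      Fintype.card (Quotient (Equiv.Perm.SameCycle.setoid (R.restrictedFace H))) :=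
    Nat.card_eq_fintype_card
  rw [Nat.card_of_isEmpty (α := {v : V // _}), add_zero, hF, ← Finset.card_univ] at heuler
  have hsum := RotationSystem.sum_faceLength (R := R) hH
  set P := Finset.univ.filter fun q => R.faceLength H q = 0 with hP
  set Q := Finset.univ.filter fun q => R.faceLength H q = 2 with hQ
  have hPQ : Disjoint P Q := by
    rw [Finset.disjoint_filter]
    intro q _ h1 h2
    omega
  have hshort : ∀ q ∈ P ∪ Q, R.faceLength H q ≤ 2 := by
    intro q hq
    simp only [hP, hQ, Finset.mem_union, Finset.mem_filter, Finset.mem_univ, true_and] at hq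
    omega
  have hinj : ∀ T : Finset _, (∀ q ∈ T, ∀ q' ∈ T, q ≠ q' → q ∈ P ∪ Q ∨ q' ∈ P ∪ Q) →
      T.card ≤ Nat.card H.ConnectedComponent := by
    intro T hT
    rw [Nat.card_eq_fintype_card, ← Finset.card_univ]
    refine Finset.card_le_card_of_injOn (R.faceComponent H) (fun _ _ => Finset.mem_univ _) ?_
    intro q hq q' hq' h
    by_contra hne
    rcases hT q hq q' hq' hne with h1 | h1
    · exact hne (RotationSystem.eq_of_faceComponent_eq hH (hshort _ h1) h)
    · exact hne (RotationSystem.eq_of_faceComponent_eq hH (hshort _ h1) h.symm).symm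
  have hcard : (P ∪ Q).card = P.card + Q.card := Finset.card_union_of_disjoint hPQ
  by_cases hlong : ∃ q, q ∉ P ∪ Q
  · right
    obtain ⟨q₀, hq₀⟩ := hlong
    have h1 := hinj (insert q₀ (P ∪ Q)) (by
      intro q hq q' hq' hne
      rw [Finset.mem_insert] at hq hq'
      rcases hq with rfl | hq
      · exact Or.inr (hq'.resolve_left hne.symm)
      · exact Or.inl hq)
    rw [Finset.card_insert_of_notMem hq₀, hcard] at h1
    have h2 : m * Finset.card (Finset.univ : Finset
        (Quotient (Equiv.Perm.SameCycle.setoid (R.restrictedFace H)))) ≤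
        2 * Nat.card H.edgeSet + m * P.card + (m - 2) * Q.card := by
      have hP' : m * P.card = ∑ q, if R.faceLength H q = 0 then m else 0 := by
        rw [← Finset.sum_filter, Finset.sum_const, smul_eq_mul, mul_comm]
      have hQ' : (m - 2) * Q.card = ∑ q, if R.faceLength H q = 2 then m - 2 else 0 := by
        rw [← Finset.sum_filter, Finset.sum_const, smul_eq_mul, mul_comm]
      rw [← hsum, hP', hQ', ← Finset.sum_add_distrib, ← Finset.sum_add_distrib, mul_comm,
        ← smul_eq_mul, ← Finset.sum_const]
      refine Finset.sum_le_sum fun q _ => ?_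
      rcases hlen q with h | h | h
      · simp [h]
      · simp [h]; omega
      · have h0 : R.faceLength H q ≠ 0 := by omega
        have h2 : R.faceLength H q ≠ 2 := by omega
        simpa [h0, h2] using h
    obtain ⟨l, rfl⟩ : ∃ l, m = l + 2 := ⟨m - 2, by omega⟩
    rw [Nat.add_sub_cancel] at h2 ⊢
    nlinarith [Nat.zero_le (l * Q.card)]
  · left
    push Not at hlong
    have h1 := hinj Finset.univ fun q _ _ _ _ => Or.inl (hlong q)
    have h2 : 2 * Nat.card H.edgeSet = 2 * Q.card := by
      have hQ' : 2 * Q.card = ∑ q, if R.faceLength H q = 2 then 2 else 0 := by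
        rw [← Finset.sum_filter, Finset.sum_const, smul_eq_mul, mul_comm]
      rw [← hsum, hQ']
      refine Finset.sum_congr rfl fun q _ => ?_
      have := hlong q
      simp only [hP, hQ, Finset.mem_union, Finset.mem_filter, Finset.mem_univ, true_and] at this
      rcases this with h | h <;> simp [h]
    omega

/-- A planar graph has at most `3 k - 6` edges in a set of `k ≥ 3` vertices. -/
theorem IsPlanar.card_edgeSet_add_six_le {V : Type*} [Finite V] {G H : SimpleGraph V}
    (hG : IsPlanar G) (hiso : ∀ v, ∃ w, G.Adj v w) (hH : H ≤ G) (S : Finset V)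
    (hS : 3 ≤ S.card) (hHS : ∀ u v, H.Adj u v → u ∈ S) :
    Nat.card H.edgeSet + 6 ≤ 3 * S.card := by
  classical
  have := Fintype.ofFinite V
  obtain ⟨R, hR⟩ := hG
  obtain ⟨s, hs⟩ : S.Nonempty := Finset.card_pos.1 (by omega)
  have hcomp : Nat.card V + 1 ≤ Nat.card H.ConnectedComponent + S.card := by
    have h1 : Nat.card (Option {v // v ∉ S}) ≤ Nat.card H.ConnectedComponent := by
      refine Nat.card_le_card_of_injective
        (fun o => H.connectedComponentMk (o.elim s Subtype.val)) ?_
      have key : ∀ (v : {v // v ∉ S}) w, H.Reachable v w → v = w := by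
        intro v w h
        rw [reachable_iff_reflTransGen] at h
        rcases h.cases_head with h | ⟨c, hc, -⟩
        · exact h
        · exact absurd (hHS _ _ hc) v.2
      rintro (_ | v) (_ | w) h
      · rfl
      · exact absurd (key w s (ConnectedComponent.exact h).symm) fun h => w.2 (h ▸ hs)
      · exact absurd (key v s (ConnectedComponent.exact h)) fun h => v.2 (h ▸ hs)
      · exact congrArg some (Subtype.ext (key v w (ConnectedComponent.exact h)))
    rw [Finite.card_option, Nat.card_eq_fintype_card, Fintype.card_subtype_compl,
      Fintype.card_coe] at h1
    have := S.card_le_univ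
    rw [Nat.card_eq_fintype_card]
    omega
  have hlen : ∀ q, R.faceLength H q = 0 ∨ R.faceLength H q = 2 ∨ 3 ≤ R.faceLength H q := by
    intro q
    induction q using Quotient.inductionOn with
    | h e =>
    have : R.faceLength H (Quotient.mk _ e) ≠ 1 := RotationSystem.ncard_sides_ne_one e
    omega
  rcases card_edgeSet_le_of_faceLength R hR hiso hH (by norm_num) hlen with h | h <;> omega

/-- A bipartite planar graph on `n ≥ 3` vertices has at most `2 n - 4` edges. -/
theorem IsPlanar.card_edgeSet_add_four_le {V : Type*} [Finite V] {G H : SimpleGraph V}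
    (hG : IsPlanar G) (hiso : ∀ v, ∃ w, G.Adj v w) (hH : H ≤ G) (hV : 3 ≤ Nat.card V)
    {s : Set V} (hs : ∀ u v, H.Adj u v → (u ∈ s ↔ v ∉ s)) :
    Nat.card H.edgeSet + 4 ≤ 2 * Nat.card V := by
  obtain ⟨R, hR⟩ := hG
  have hcomp : 0 < Nat.card H.ConnectedComponent := by
    have : Nonempty V := (Nat.card_pos_iff.1 (by omega)).1
    have : Nonempty H.ConnectedComponent := this.map H.connectedComponentMk
    exact Nat.card_pos
  have hlen : ∀ q, R.faceLength H q = 0 ∨ R.faceLength H q = 2 ∨ 4 ≤ R.faceLength H q := by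
    intro q
    induction q using Quotient.inductionOn with
    | h e =>
    obtain ⟨r, hr⟩ : Even (R.faceLength H (Quotient.mk _ e)) :=
      RotationSystem.even_ncard_sides hs e
    omega
  rcases card_edgeSet_le_of_faceLength R hR hiso hH (by norm_num) hlen with h | h <;> omega

/-! ### Lower bounds for the order -/

theorem ncard_neighborSet_eq_degree {V : Type*} (G : SimpleGraph V) (v : V)
    [Fintype (G.neighborSet v)] : (G.neighborSet v).ncard = G.degree v := by
  rw [Set.ncard_eq_toFinset_card', ← card_neighborFinset_eq_degree]
  rfl

theorem IsKConnected.le_ncard_neighborSet {V : Type*} [Finite V] {k : ℕ} {G : SimpleGraph V}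
    (hG : IsKConnected k G) (v : V) : k ≤ (G.neighborSet v).ncard := by
  classical
  have := Fintype.ofFinite V
  by_contra! hlt
  rw [ncard_neighborSet_eq_degree, ← card_neighborFinset_eq_degree] at hlt
  have hconn := hG.2 _ hlt
  obtain ⟨w, hw⟩ : ∃ w, w ∉ insert v (G.neighborFinset v) := by
    by_contra! hall
    have h1 := Finset.card_insert_le v (G.neighborFinset v)
    rw [Finset.eq_univ_of_forall hall, Finset.card_univ] at h1
    have h2 := hG.1
    rw [Nat.card_eq_fintype_card] at h2
    omega
  rw [Finset.mem_insert, not_or] at hw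
  have hr := hconn.preconnected ⟨v, by simp⟩ ⟨w, hw.2⟩
  rw [reachable_iff_reflTransGen] at hr
  rcases hr.cases_head with h | ⟨⟨c, hc⟩, hvc, -⟩
  · exact hw.1 (congrArg Subtype.val h).symm
  · exact hc ((G.mem_neighborFinset _ _).2 hvc)

theorem IsPolytopal.exists_adj {V : Type*} [Finite V] {G : SimpleGraph V} (hG : IsPolytopal G)
    (v : V) : ∃ w, G.Adj v w := by
  have h := hG.2.le_ncard_neighborSet v
  exact Set.nonempty_of_ncard_ne_zero (by omega : (G.neighborSet v).ncard ≠ 0)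

/-- The bound given by the number of edges of a planar graph and the minimal degree `3`. -/
theorem sum_sub_three_add_twelve_le {p n : ℕ} (hp : p ∈ polytopalOrders n) :
    ∑ i ∈ Finset.Icc 3 n, (i - 3) + 12 ≤ 3 * p := by
  classical
  obtain ⟨G, hG, hdeg⟩ := hp
  have hcard : 4 ≤ p := by simpa using hG.2.1
  have : Nonempty (Fin p) := ⟨⟨0, by omega⟩⟩
  choose! f hf using hdeg
  have hE := IsPlanar.card_edgeSet_add_six_le hG.1 hG.exists_adj le_rfl Finset.univ
    (by simp; omega) fun _ _ _ => Finset.mem_univ _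
  have hinj : Set.InjOn f (Finset.Icc 3 n) := by
    intro i hi j hj hij
    rw [Finset.coe_Icc, Set.mem_Icc] at hi hj
    rw [← hf i hi.1 hi.2, hij, hf j hj.1 hj.2]
  have h1 : ∑ i ∈ Finset.Icc 3 n, (i - 3) ≤ ∑ v, (G.degree v - 3) := by
    calc ∑ i ∈ Finset.Icc 3 n, (i - 3) = ∑ i ∈ Finset.Icc 3 n, (G.degree (f i) - 3) := by
          refine Finset.sum_congr rfl fun i hi => ?_
          rw [Finset.mem_Icc] at hi
          rw [← ncard_neighborSet_eq_degree, hf i hi.1 hi.2]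
      _ = ∑ v ∈ (Finset.Icc 3 n).image f, (G.degree v - 3) :=
          (Finset.sum_image (f := fun v => G.degree v - 3) hinj).symm
      _ ≤ ∑ v, (G.degree v - 3) := Finset.sum_le_sum_of_subset (Finset.subset_univ _)
  have h2 : ∑ v, (G.degree v - 3) + ∑ _v : Fin p, 3 = 2 * Nat.card G.edgeSet := by
    rw [Nat.card_eq_fintype_card, ← edgeFinset_card, ← G.sum_degrees_eq_twice_card_edges,
      ← Finset.sum_add_distrib]
    refine Finset.sum_congr rfl fun v _ => Nat.sub_add_cancel ?_
    rw [← ncard_neighborSet_eq_degree]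
    exact hG.2.le_ncard_neighborSet v
  simp only [Finset.sum_const, Finset.card_univ, Fintype.card_fin, smul_eq_mul] at h2 hE
  omega

/-- The bound given by vertices of the degrees `a, …, n`: these are at least three vertices, so
they span a planar graph, and the edges to the other vertices form a bipartite planar graph. -/
theorem sum_Icc_add_sixteen_le {p n a : ℕ} (hp : p ∈ polytopalOrders n) (ha : 3 ≤ a)
    (han : a + 2 ≤ n) : ∑ i ∈ Finset.Icc a n, i + 16 ≤ 2 * p + 6 * (n + 1 - a) := by
  classical
  obtain ⟨G, hG, hdeg⟩ := hp
  have hcard : 4 ≤ p := by simpa using hG.2.1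
  have : Nonempty (Fin p) := ⟨⟨0, by omega⟩⟩
  choose! f hf using hdeg
  have hinj : Set.InjOn f (Finset.Icc a n) := by
    intro i hi j hj hij
    rw [Finset.coe_Icc, Set.mem_Icc] at hi hj
    rw [← hf i (ha.trans hi.1) hi.2, hij, hf j (ha.trans hj.1) hj.2]
  obtain ⟨S, hS⟩ : ∃ S, S = (Finset.Icc a n).image f := ⟨_, rfl⟩
  have hsumS : ∀ g : Fin p → ℕ, ∑ v ∈ S, g v = ∑ i ∈ Finset.Icc a n, g (f i) := by
    intro g
    rw [hS, Finset.sum_image hinj]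
  have hScard : S.card = n + 1 - a := by
    rw [hS, Finset.card_image_of_injOn hinj, Nat.card_Icc]
  let H₁ : SimpleGraph (Fin p) :=
    { Adj := fun u v => G.Adj u v ∧ u ∈ S ∧ v ∈ S
      symm := ⟨fun _ _ h => ⟨h.1.symm, h.2.2, h.2.1⟩⟩
      loopless := ⟨fun _ h => h.1.ne rfl⟩ }
  let H₂ : SimpleGraph (Fin p) :=
    { Adj := fun u v => G.Adj u v ∧ (u ∈ S ↔ v ∉ S)
      symm := ⟨fun _ _ h => ⟨h.1.symm, by tauto⟩⟩
      loopless := ⟨fun _ h => h.1.ne rfl⟩ }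
  have hE₁ := IsPlanar.card_edgeSet_add_six_le (H := H₁) hG.1 hG.exists_adj (fun _ _ h => h.1) S
    (by omega) fun _ _ h => h.2.1
  have hE₂ := IsPlanar.card_edgeSet_add_four_le (H := H₂) (s := (S : Set (Fin p))) hG.1
    hG.exists_adj (fun _ _ h => h.1) (by simp; omega) fun _ _ h => by simpa using h.2
  rw [Nat.card_eq_fintype_card, ← edgeFinset_card] at hE₁ hE₂
  have h1 : ∑ v ∈ S, H₁.degree v = 2 * H₁.edgeFinset.card := by
    rw [← H₁.sum_degrees_eq_twice_card_edges]
    refine Finset.sum_subset (Finset.subset_univ _) fun v _ hv => ?_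
    rw [← card_neighborFinset_eq_degree, Finset.card_eq_zero, Finset.eq_empty_iff_forall_notMem]
    exact fun w hw => hv ((H₁.mem_neighborFinset _ _).1 hw).2.1
  have h2 : ∑ v ∈ S, H₂.degree v = H₂.edgeFinset.card := by
    refine isBipartiteWith_sum_degrees_eq_card_edges (t := Sᶜ) ⟨?_, ?_⟩
    · simpa using disjoint_compl_right
    · intro u v h
      have := h.2
      simp only [Finset.mem_coe, Finset.mem_compl]
      tauto
  have h3 : ∑ i ∈ Finset.Icc a n, i = ∑ v ∈ S, (H₁.degree v + H₂.degree v) := by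
    rw [hsumS]
    refine Finset.sum_congr rfl fun i hi => ?_
    have hfi : f i ∈ S := hS ▸ Finset.mem_image_of_mem f hi
    rw [Finset.mem_Icc] at hi
    conv_lhs => rw [← hf i (ha.trans hi.1) hi.2, ncard_neighborSet_eq_degree]
    rw [← card_neighborFinset_eq_degree, ← card_neighborFinset_eq_degree,
      ← card_neighborFinset_eq_degree, ← Finset.card_union_of_disjoint]
    · congr 1
      ext w
      simp only [Finset.mem_union, mem_neighborFinset, H₁, H₂]
      tauto
    · rw [Finset.disjoint_left]
      intro w hw hw'
      rw [mem_neighborFinset] at hw hw'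
      exact hw'.2.1 hfi hw.2.2
  rw [Finset.sum_add_distrib, h1, h2] at h3
  rw [Nat.card_eq_fintype_card, Fintype.card_fin] at hE₂
  omega

theorem le_of_mem_polytopalOrders {p n : ℕ} (hp : p ∈ polytopalOrders n) (hn : 14 ≤ n) :
    n ^ 2 + 62 ≤ 4 * p + 11 * n := by
  have h := sum_Icc_add_sixteen_le hp (a := 7) (by norm_num) (by omega)
  have hsum : ∀ m, 2 * ∑ i ∈ Finset.Icc 7 (m + 7), i = (m + 1) * (m + 14) := by
    intro m
    induction m with
    | zero => simp
    | succ m ih =>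
      rw [show m + 1 + 7 = m + 7 + 1 by ring, Finset.sum_Icc_succ_top (by omega), mul_add, ih]
      ring
  obtain ⟨m, rfl⟩ : ∃ m, n = m + 7 := ⟨n - 7, by omega⟩
  have := hsum m
  have h' : m + 7 + 1 - 7 = m + 1 := by omega
  rw [h'] at h
  nlinarith

theorem succ_le_of_mem_polytopalOrders {p n : ℕ} (hp : p ∈ polytopalOrders n) (hn : 3 ≤ n) :
    n + 1 ≤ p := by
  classical
  obtain ⟨G, -, hdeg⟩ := hp
  obtain ⟨v, hv⟩ := hdeg n hn le_rfl
  rw [ncard_neighborSet_eq_degree] at hv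
  have := G.degree_lt_card_verts v
  rw [Fintype.card_fin] at this
  omega

/-! ### Triangulations of the sphere given as data -/

namespace GraphData

/-- Adjacency of the vertices `u` and `v` of a graph given as data. -/
def HasEdge (G : GraphData) (u v : ℕ) : Prop := (u, v) ∈ G.edges ∨ (v, u) ∈ G.edges

theorem HasEdge.symm {G : GraphData} {u v : ℕ} (h : G.HasEdge u v) : G.HasEdge v u := Or.symm h

/-- `G` is a `3`-connected triangulation of the sphere. The embedding is given by the function `t`:
the face on the left of the dart `(u, v)` is the triangle `(u, v, t u v)`. So the dart `(v, x)` is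
followed by `(v, t x v)` in the rotation at `v`. -/
structure IsTriangulation (G : GraphData) (t : ℕ → ℕ → ℕ) : Prop where
  four_le : 4 ≤ G.order
  lt : ∀ e ∈ G.edges, e.1 < e.2 ∧ e.2 < G.order
  nodup : G.edges.Nodup
  length_edges : G.edges.length + 6 = 3 * G.order
  face : ∀ u v, G.HasEdge u v → G.HasEdge v (t u v) ∧ t v (t u v) = u
  turn : ∀ v x y, G.HasEdge v x → G.HasEdge v y →
    Relation.ReflTransGen (fun x y => t x v = y) x y
  conn : IsKConnected 3 G.toGraph

namespace IsTriangulation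

variable {G : GraphData} {t : ℕ → ℕ → ℕ}

theorem ne_of_hasEdge (h : G.IsTriangulation t) {u v : ℕ} (huv : G.HasEdge u v) : u ≠ v := by
  rcases huv with h' | h'
  · exact (h.lt _ h').1.ne
  · exact (h.lt _ h').1.ne'

theorem lt_of_hasEdge (h : G.IsTriangulation t) {u v : ℕ} (huv : G.HasEdge u v) :
    u < G.order := by
  rcases huv with h' | h'
  · exact (h.lt _ h').1.trans (h.lt _ h').2
  · exact (h.lt _ h').2

theorem adj_iff (h : G.IsTriangulation t) (u v : Fin G.order) :
    G.toGraph.Adj u v ↔ G.HasEdge u v := by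
  rw [toGraph, fromRel_adj]
  exact ⟨fun h' => h'.2, fun h' => ⟨fun he => h.ne_of_hasEdge h' (congrArg _ he), h'⟩⟩

theorem card_edgeSet (h : G.IsTriangulation t) :
    Nat.card G.toGraph.edgeSet = G.edges.length := by
  classical
  rw [Nat.card_eq_fintype_card, ← edgeFinset_card, ← List.toFinset_card_of_nodup h.nodup]
  symm
  refine Finset.card_bij (fun e he => s(⟨e.1, ?_⟩, ⟨e.2, ?_⟩)) ?_ ?_ ?_
  · have := h.lt e (List.mem_toFinset.1 he)
    omega
  · exact (h.lt e (List.mem_toFinset.1 he)).2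
  · intro e he
    rw [mem_edgeFinset, mem_edgeSet, h.adj_iff]
    exact Or.inl (List.mem_toFinset.1 he)
  · intro e he e' he' heq
    have h1 := h.lt e (List.mem_toFinset.1 he)
    have h2 := h.lt e' (List.mem_toFinset.1 he')
    simp only [Sym2.eq_iff, Fin.mk.injEq] at heq
    rcases heq with ⟨h3, h4⟩ | ⟨h3, h4⟩
    · exact Prod.ext h3 h4
    · omega
  · intro e
    induction e using Sym2.ind with
    | h u v =>
    intro he
    rw [mem_edgeFinset, mem_edgeSet, h.adj_iff] at he
    rcases he with he | he
    · exact ⟨_, List.mem_toFinset.2 he, rfl⟩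
    · exact ⟨_, List.mem_toFinset.2 he, Sym2.eq_swap⟩

/-- The dart that follows `d` in the rotation at its source. -/
def nextDart (h : G.IsTriangulation t) (d : G.toGraph.Dart) : G.toGraph.Dart :=
  have hd := (h.face _ _ ((h.adj_iff _ _).1 d.adj.symm)).1
  ⟨(d.fst, ⟨t d.snd d.fst, h.lt_of_hasEdge hd.symm⟩), (h.adj_iff _ _).2 hd⟩

theorem nextDart_injective (h : G.IsTriangulation t) : Function.Injective h.nextDart := by
  intro d e hde
  have h1 : (h.nextDart d).fst = (h.nextDart e).fst := by rw [hde]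
  have h2 : ((h.nextDart d).snd : ℕ) = (h.nextDart e).snd := by rw [hde]
  change d.fst = e.fst at h1
  change t d.snd d.fst = t e.snd e.fst at h2
  have h3 := (h.face _ _ ((h.adj_iff _ _).1 d.adj.symm)).2
  have h4 := (h.face _ _ ((h.adj_iff _ _).1 e.adj.symm)).2
  refine Dart.ext _ _ (Prod.ext h1 (Fin.ext ?_))
  rw [← h3, ← h4, h2, h1]

/-- The rotation system of a triangulation. -/
noncomputable def rotationSystem (h : G.IsTriangulation t) : RotationSystem G.toGraph where
  next := Equiv.ofBijective h.nextDart (Finite.injective_iff_bijective.1 h.nextDart_injective)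
  next_fst _ := rfl
  sameCycle := by
    rintro ⟨⟨v, x⟩, hx⟩ ⟨⟨v', y⟩, hy⟩ hv
    obtain rfl : v = v' := hv
    have hxy := h.turn v x y ((h.adj_iff _ _).1 hx) ((h.adj_iff _ _).1 hy)
    suffices H : ∀ z, Relation.ReflTransGen (fun x y => t x (v : ℕ) = y) (x : ℕ) z →
        ∃ (hz : z < G.order) (hvz : G.toGraph.Adj v ⟨z, hz⟩),
          Equiv.Perm.SameCycle (Equiv.ofBijective h.nextDart
            (Finite.injective_iff_bijective.1 h.nextDart_injective))
            ⟨(v, x), hx⟩ ⟨(v, ⟨z, hz⟩), hvz⟩ from (H y hxy).2.2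
    intro z hz
    induction hz with
    | refl => exact ⟨x.2, hx, .refl _ _⟩
    | @tail y z _ hyz ih =>
      obtain ⟨hy, hvy, hc⟩ := ih
      subst hyz
      exact ⟨_, _, hc.trans (Equiv.Perm.SameCycle.apply_self _ _)⟩

end IsTriangulation

end GraphData

theorem Equiv.Perm.three_mul_numCycles {α : Type*} [Finite α] (f : Equiv.Perm α)
    (h₁ : ∀ x, f x ≠ x) (h₃ : ∀ x, f (f (f x)) = x) : 3 * f.numCycles = Nat.card α := by
  classical
  have := Fintype.ofFinite α
  have := Fintype.ofFinite (Quotient (SameCycle.setoid f))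
  have hsame : ∀ x y, f.SameCycle x y ↔ y ∈ ({x, f x, f (f x)} : Finset α) := by
    intro x y
    simp only [Finset.mem_insert, Finset.mem_singleton]
    refine ⟨fun h => h.induct (P := fun x y => y = x ∨ y = f x ∨ y = f (f x))
      (fun _ => Or.inl rfl) ?_ (fun _ => Or.inr (Or.inl rfl)), ?_⟩
    · rintro a b c (rfl | rfl | rfl) (rfl | rfl | rfl) <;> simp [h₃]
    · rintro (rfl | rfl | rfl)
      · exact .refl _ _
      · exact .apply_self _ _
      · exact (SameCycle.apply_self _ _).trans (.apply_self _ _)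
  have hcard : ∀ x, ({x, f x, f (f x)} : Finset α).card = 3 := by
    intro x
    refine Finset.card_eq_three.2 ⟨_, _, _, (h₁ x).symm, fun h => ?_, (h₁ (f x)).symm, rfl⟩
    exact h₁ (f (f x)) (by rw [h₃]; exact h)
  have hfib := Finset.card_eq_sum_card_fiberwise (s := (Finset.univ : Finset α))
    (t := Finset.univ) (f := fun x => Quotient.mk (SameCycle.setoid f) x)
    (fun _ _ => Finset.mem_coe.2 (Finset.mem_univ _))
  rw [Finset.sum_congr rfl (g := fun _ => 3), Finset.sum_const, smul_eq_mul] at hfib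
  · rw [numCycles, Nat.card_eq_fintype_card, Nat.card_eq_fintype_card, ← Finset.card_univ,
      ← Finset.card_univ, hfib, mul_comm]
  · intro q _
    induction q using Quotient.inductionOn with
    | h x =>
    rw [← hcard x]
    congr 1
    ext y
    rw [← hsame, Finset.mem_filter, Quotient.eq]
    exact ⟨fun h => h.2.symm, fun h => ⟨Finset.mem_univ _, h.symm⟩⟩

theorem IsKConnected.connected {V : Type*} [Finite V] {k : ℕ} {G : SimpleGraph V}
    (hG : IsKConnected k G) (hk : 0 < k) : G.Connected := by
  have h := hG.2 ∅ (by simpa using hk)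
  exact (h.map (Embedding.induce _).toHom fun v => ⟨⟨v, by simp⟩, rfl⟩)

namespace GraphData.IsTriangulation

variable {G : GraphData} {t : ℕ → ℕ → ℕ}

theorem rotationSystem_face (h : G.IsTriangulation t) (d : G.toGraph.Dart) :
    (h.rotationSystem.face d).fst = d.snd ∧ ((h.rotationSystem.face d).snd : ℕ) = t d.fst d.snd :=
  ⟨rfl, rfl⟩

/-- All faces are triangles, so the number of edges gives the Euler characteristic `2`. -/
theorem isPolytopal (h : G.IsTriangulation t) : IsPolytopal G.toGraph := by
  classical
  refine ⟨⟨h.rotationSystem, ?_⟩, h.conn⟩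
  have hcomp : Nat.card G.toGraph.ConnectedComponent = 1 := by
    have := h.conn.connected (by norm_num)
    have h1 := this.preconnected.subsingleton_connectedComponent
    have h2 := this.nonempty.map G.toGraph.connectedComponentMk
    exact Nat.card_eq_one_iff_unique.2 ⟨h1, h2⟩
  have hiso : IsEmpty {v // ∀ w, ¬ G.toGraph.Adj v w} := by
    refine ⟨fun v => ?_⟩
    have h1 := h.conn.le_ncard_neighborSet v.1
    obtain ⟨w, hw⟩ := Set.nonempty_of_ncard_ne_zero
      (by omega : (G.toGraph.neighborSet v.1).ncard ≠ 0)
    exact v.2 w hw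
  have hface : 3 * h.rotationSystem.face.numCycles = 2 * G.edges.length := by
    rw [Equiv.Perm.three_mul_numCycles, ← h.card_edgeSet, Nat.card_eq_fintype_card,
      Nat.card_eq_fintype_card, ← edgeFinset_card, G.toGraph.dart_card_eq_twice_card_edges]
    · intro d hd
      exact d.adj.ne (by rw [← (h.rotationSystem_face d).1, hd])
    · intro d
      have hd := (h.adj_iff _ _).1 d.adj
      have h1 := (h.face _ _ hd).2
      have h2 := (h.face _ _ (h.face _ _ hd).1).2
      refine Dart.ext _ _ (Prod.ext (Fin.ext ?_) (Fin.ext ?_))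
      · exact h1
      · change t (t d.fst d.snd) (t d.snd (t d.fst d.snd)) = _
        rw [h1] at h2 ⊢
        exact h2
  unfold RotationSystem.numFaces
  rw [Nat.card_of_isEmpty (α := {v // _}), hcomp, h.card_edgeSet, Nat.card_eq_fintype_card,
    Fintype.card_fin]
  have := h.length_edges
  unfold Equiv.Perm.numCycles at hface
  omega

end GraphData.IsTriangulation

/-! ### Splitting a face of a triangulation -/

namespace GraphData

variable {G : GraphData} {t : ℕ → ℕ → ℕ}

theorem order_split (x y z : ℕ) : (G.split x y z).order = G.order + 1 := rfl

theorem hasEdge_split {x y z u v : ℕ} : (G.split x y z).HasEdge u v ↔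
    G.HasEdge u v ∨ (v = G.order ∧ u ∈ ({x, y, z} : Finset ℕ)) ∨
      (u = G.order ∧ v ∈ ({x, y, z} : Finset ℕ)) := by
  simp only [HasEdge, split, List.mem_cons, Prod.mk.injEq, Finset.mem_insert,
    Finset.mem_singleton]
  tauto

/-- The triangle `f` bounds a face of the triangulation `t`. -/
def IsFace (G : GraphData) (t : ℕ → ℕ → ℕ) (f : Finset ℕ) : Prop :=
  ∃ a b, G.HasEdge a b ∧ f = {a, b, t a b}

/-- The faces after a new vertex `d` was put into the face `(a, b, t a b)`. -/
def splitFace (t : ℕ → ℕ → ℕ) (a b d : ℕ) (u v : ℕ) : ℕ :=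
  if u = d then (if v = a then b else if v = b then t a b else a)
  else if v = d then (if u = b then a else if u = t a b then b else t a b)
  else if (u = a ∧ v = b) ∨ (u = b ∧ v = t a b) ∨ (u = t a b ∧ v = a) then d
  else t u v

/-- A new vertex with at least `k` neighbours keeps a graph `k`-connected. -/
theorem isKConnected_succ {k n : ℕ} {Γ : SimpleGraph (Fin n)} {Γ' : SimpleGraph (Fin (n + 1))}
    (h : IsKConnected k Γ) (hle : ∀ u v, Γ.Adj u v → Γ'.Adj u.castSucc v.castSucc)
    (N : Finset (Fin n)) (hN : k ≤ N.card) (hnew : ∀ u ∈ N, Γ'.Adj (Fin.last n) u.castSucc) :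
    IsKConnected k Γ' := by
  classical
  refine ⟨?_, fun S hS => ?_⟩
  · have := h.1
    simp only [Nat.card_eq_fintype_card, Fintype.card_fin] at this ⊢
    omega
  let S₀ : Finset (Fin n) := Finset.univ.filter fun u => u.castSucc ∈ S
  have hS₀ : S₀.card < k := by
    refine lt_of_le_of_lt ?_ hS
    refine Finset.card_le_card_of_injOn Fin.castSucc (fun u hu => ?_)
      (Fin.castSucc_injective n).injOn
    exact (Finset.mem_filter.1 hu).2
  have hmem : ∀ u : Fin n, u ∉ S₀ → u.castSucc ∉ S := fun u hu hu' =>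
    hu (Finset.mem_filter.2 ⟨Finset.mem_univ _, hu'⟩)
  have hconn := h.2 S₀ hS₀
  let φ : Γ.induce {v | v ∉ S₀} →g Γ'.induce {v | v ∉ S} :=
    { toFun := fun u => ⟨u.1.castSucc, hmem _ u.2⟩
      map_rel' := fun {u v} huv => hle _ _ huv }
  obtain ⟨u₀⟩ := hconn.nonempty
  have key : ∀ v : {v : Fin (n + 1) | v ∉ S}, (Γ'.induce {v | v ∉ S}).Reachable v (φ u₀) := by
    have hold : ∀ (u : Fin n) (hu : u.castSucc ∉ S),
        (Γ'.induce {v | v ∉ S}).Reachable ⟨u.castSucc, hu⟩ (φ u₀) := fun u hu =>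
      (hconn.preconnected ⟨u, fun hu' => hu (Finset.mem_filter.1 hu').2⟩ u₀).map φ
    rintro ⟨v, hv⟩
    induction v using Fin.lastCases with
    | cast u => exact hold u hv
    | last =>
      obtain ⟨u, huN, huS⟩ := Finset.exists_mem_notMem_of_card_lt_card (hS₀.trans_le hN)
      have hadj : (Γ'.induce {v | v ∉ S}).Adj ⟨Fin.last n, hv⟩ ⟨u.castSucc, hmem u huS⟩ :=
        hnew u huN
      exact hadj.reachable.trans (hold u _)
  exact (connected_iff _).2 ⟨fun v w => (key v).trans (key w).symm, ⟨φ u₀⟩⟩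

namespace IsTriangulation

/-- The edges, darts and vertices of the face `(a, b, t a b)`. -/
theorem face_facts (h : G.IsTriangulation t) {a b : ℕ} (hab : G.HasEdge a b) :
    G.HasEdge b (t a b) ∧ G.HasEdge (t a b) a ∧ t b (t a b) = a ∧ t (t a b) a = b ∧
      a ≠ b ∧ b ≠ t a b ∧ t a b ≠ a ∧ a < G.order ∧ b < G.order ∧ t a b < G.order := by
  obtain ⟨h1, h2⟩ := h.face a b hab
  obtain ⟨h3, h4⟩ := h.face _ _ h1
  rw [h2] at h3 h4
  exact ⟨h1, h3, h2, h4, h.ne_of_hasEdge hab, h.ne_of_hasEdge h1, h.ne_of_hasEdge h3,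
    h.lt_of_hasEdge hab, h.lt_of_hasEdge h1, h.lt_of_hasEdge h3⟩

variable {x y z a b : ℕ}

theorem splitFace_face (h : G.IsTriangulation t) (hab : G.HasEdge a b)
    (hxyz : ({x, y, z} : Finset ℕ) = {a, b, t a b}) {u v : ℕ}
    (huv : (G.split x y z).HasEdge u v) :
    (G.split x y z).HasEdge v (splitFace t a b G.order u v) ∧
      splitFace t a b G.order v (splitFace t a b G.order u v) = u := by
  obtain ⟨h1, h2, h3, h4, h5, h6, h7, h8, h9, h10⟩ := h.face_facts hab
  simp only [hasEdge_split, hxyz, Finset.mem_insert, Finset.mem_singleton] at huv ⊢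
  unfold splitFace
  rcases huv with huv | ⟨rfl, huv⟩ | ⟨rfl, huv⟩
  · have hu := h.lt_of_hasEdge huv
    have hv := h.lt_of_hasEdge huv.symm
    obtain ⟨h11, h12⟩ := h.face u v huv
    have hw := h.lt_of_hasEdge h11.symm
    have h13 := (h.face _ _ h11).2
    by_cases hs : (u = a ∧ v = b) ∨ (u = b ∧ v = t a b) ∨ (u = t a b ∧ v = a)
    · rcases hs with ⟨rfl, rfl⟩ | ⟨rfl, rfl⟩ | ⟨rfl, rfl⟩ <;> grind
    · rw [if_neg hu.ne, if_neg hv.ne, if_neg hs, if_neg hv.ne, if_neg hw.ne, if_neg]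
      · exact ⟨Or.inl h11, h12⟩
      · rintro (⟨rfl, h14⟩ | ⟨rfl, h14⟩ | ⟨rfl, h14⟩) <;> grind
  · rcases huv with rfl | rfl | rfl <;> grind
  · rcases huv with rfl | rfl | rfl <;> grind

theorem splitFace_turn (h : G.IsTriangulation t) (hab : G.HasEdge a b)
    (hxyz : ({x, y, z} : Finset ℕ) = {a, b, t a b}) {v p q : ℕ}
    (hp : (G.split x y z).HasEdge v p) (hq : (G.split x y z).HasEdge v q) :
    Relation.ReflTransGen (fun p q => splitFace t a b G.order p v = q) p q := by
  obtain ⟨h1, h2, h3, h4, h5, h6, h7, h8, h9, h10⟩ := h.face_facts hab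
  simp only [hasEdge_split, hxyz, Finset.mem_insert, Finset.mem_singleton] at hp hq
  by_cases hv : v = G.order
  · have hno : ∀ p, ¬ G.HasEdge v p := fun p hvp => (h.lt_of_hasEdge hvp).ne hv
    have hne : ∀ p, p = a ∨ p = b ∨ p = t a b → p ≠ G.order := by
      rintro p (rfl | rfl | rfl) <;> omega
    have hp' : p = a ∨ p = b ∨ p = t a b := by
      rcases hp with hp | ⟨hp, hp'⟩ | hp
      · exact absurd hp (hno p)
      · exact absurd hv (hne v hp')
      · exact hp.2
    have hq' : q = a ∨ q = b ∨ q = t a b := by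
      rcases hq with hq | ⟨hq, hq'⟩ | hq
      · exact absurd hq (hno q)
      · exact absurd hv (hne v hq')
      · exact hq.2
    subst hv
    have s1 : splitFace t a b G.order a G.order = t a b := by unfold splitFace; grind
    have s2 : splitFace t a b G.order (t a b) G.order = b := by unfold splitFace; grind
    have s3 : splitFace t a b G.order b G.order = a := by unfold splitFace; grind
    have r1 : Relation.ReflTransGen (fun p q => splitFace t a b G.order p G.order = q)
      a (t a b) := .single s1
    have r2 : Relation.ReflTransGen (fun p q => splitFace t a b G.order p G.order = q)
      (t a b) b := .single s2
    have r3 : Relation.ReflTransGen (fun p q => splitFace t a b G.order p G.order = q)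
      b a := .single s3
    rcases hp' with rfl | rfl | rfl <;> rcases hq' with rfl | rfl | rfl
    · exact .refl
    · exact r1.trans r2
    · exact r1
    · exact r3
    · exact .refl
    · exact r3.trans r1
    · exact r2.trans r3
    · exact r2
    · exact .refl
  · -- A step of the old rotation that crosses the split face becomes two steps via the new vertex.
    have hstep : ∀ p, G.HasEdge v p → Relation.ReflTransGen
        (fun p q => splitFace t a b G.order p v = q) p (t p v) := by
      intro p hvp
      have hp := h.lt_of_hasEdge hvp.symm
      by_cases hs : (p = a ∧ v = b) ∨ (p = b ∧ v = t a b) ∨ (p = t a b ∧ v = a)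
      · have e1 : splitFace t a b G.order p v = G.order := by unfold splitFace; grind
        have e2 : splitFace t a b G.order G.order v = t p v := by unfold splitFace; grind
        exact .tail (.single e1) e2
      · have e1 : splitFace t a b G.order p v = t p v := by unfold splitFace; grind
        exact .single e1
    have hold : ∀ p q, G.HasEdge v p → G.HasEdge v q → Relation.ReflTransGen
        (fun p q => splitFace t a b G.order p v = q) p q := by
      intro p q hp hq
      have := h.turn v p q hp hq
      clear hq
      induction this using Relation.ReflTransGen.head_induction_on with
      | refl => exact .refl
      | head hbc _ ih =>
        subst hbc
        exact (hstep _ hp).trans (ih (h.face _ _ hp.symm).1)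
    have hto : v = a ∨ v = b ∨ v = t a b → ∃ r s, G.HasEdge v r ∧ G.HasEdge v s ∧
        splitFace t a b G.order r v = G.order ∧ splitFace t a b G.order G.order v = s := by
      rintro (rfl | rfl | rfl)
      · exact ⟨t v b, b, h2.symm, hab, by unfold splitFace; grind, by unfold splitFace; grind⟩
      · exact ⟨a, t a v, hab.symm, h1, by unfold splitFace; grind, by unfold splitFace; grind⟩
      · exact ⟨b, a, h1.symm, h2, by unfold splitFace; grind, by unfold splitFace; grind⟩
    rcases hp with hp | ⟨rfl, hp⟩ | ⟨hp, -⟩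
    · rcases hq with hq | ⟨rfl, hq⟩ | ⟨hq, -⟩
      · exact hold p q hp hq
      · obtain ⟨r, s, hr, -, hr', -⟩ := hto hq
        exact (hold p r hp hr).tail hr'
      · exact absurd hq hv
    · rcases hq with hq | ⟨rfl, hq⟩ | ⟨hq, -⟩
      · obtain ⟨r, s, -, hs, -, hs'⟩ := hto hp
        exact .head hs' (hold s q hs hq)
      · exact .refl
      · exact absurd hq hv
    · exact absurd hp hv

theorem split (h : G.IsTriangulation t) (hab : G.HasEdge a b)
    (hxyz : ({x, y, z} : Finset ℕ) = {a, b, t a b}) :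
    (G.split x y z).IsTriangulation (splitFace t a b G.order) := by
  classical
  obtain ⟨h1, h2, h3, h4, h5, h6, h7, h8, h9, h10⟩ := h.face_facts hab
  have hcard : ({x, y, z} : Finset ℕ).card = 3 := by
    rw [hxyz]
    exact Finset.card_eq_three.2 ⟨a, b, t a b, h5, h7.symm, h6, rfl⟩
  have hlt : ∀ u ∈ ({x, y, z} : Finset ℕ), u < G.order := by
    rw [hxyz]
    simp [h8, h9, h10]
  have hx := hlt x (by simp)
  have hy := hlt y (by simp)
  have hz := hlt z (by simp)
  have hxyz' : x ≠ y ∧ x ≠ z ∧ y ≠ z := by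
    refine ⟨?_, ?_, ?_⟩ <;> rintro rfl <;> revert hcard
    · rw [Finset.insert_eq_of_mem (by simp)]
      exact fun hc => absurd (Finset.card_le_two (a := x) (b := z)) (by omega)
    · rw [Finset.insert_eq_of_mem (by simp)]
      exact fun hc => absurd (Finset.card_le_two (a := y) (b := x)) (by omega)
    · rw [Finset.pair_eq_singleton]
      exact fun hc => absurd (Finset.card_le_two (a := x) (b := y)) (by omega)
  have hlt' : ∀ e ∈ (G.split x y z).edges, e.1 < e.2 ∧ e.2 < (G.split x y z).order := by
    intro e he
    simp only [GraphData.split, List.mem_cons] at he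
    rw [order_split]
    rcases he with rfl | rfl | rfl | he
    · exact ⟨hx, Nat.lt_succ_self _⟩
    · exact ⟨hy, Nat.lt_succ_self _⟩
    · exact ⟨hz, Nat.lt_succ_self _⟩
    · have := h.lt e he
      exact ⟨this.1, this.2.trans (Nat.lt_succ_self _)⟩
  refine ⟨?_, hlt', ?_, ?_, fun u v => h.splitFace_face hab hxyz,
    fun v p q => h.splitFace_turn hab hxyz, ?_⟩
  · exact h.four_le.trans (Nat.le_succ _)
  · have hnew : ∀ u, (u, G.order) ∉ G.edges := fun u hu => (h.lt _ hu).2.false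
    simp [GraphData.split, hnew, hxyz', h.nodup]
  · have := h.length_edges
    simp only [GraphData.split, List.length_cons]
    omega
  · refine isKConnected_succ h.conn (N := Finset.univ.filter fun u : Fin G.order =>
      (u : ℕ) ∈ ({x, y, z} : Finset ℕ)) ?_ ?_ ?_
    · intro u v huv
      rw [h.adj_iff] at huv
      refine (fromRel_adj _ _ _).2 ⟨fun he => h.ne_of_hasEdge huv
        (congrArg (fun w : Fin (G.order + 1) => (w : ℕ)) he), ?_⟩
      exact hasEdge_split.2 (Or.inl huv)
    · rw [← hcard]
      refine Finset.card_le_card_of_injOn (fun u => if hu : u < G.order then ⟨u, hu⟩ else ⟨x, hx⟩)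
        ?_ ?_
      · intro u hu
        simpa [hlt u hu] using hu
      · intro u hu v hv huv
        simpa [hlt u hu, hlt v hv] using huv
    · intro u hu
      refine (fromRel_adj _ _ _).2 ⟨fun he => u.2.ne (congrArg Fin.val he).symm, ?_⟩
      exact hasEdge_split.2 (Or.inr (Or.inr ⟨rfl, (Finset.mem_filter.1 hu).2⟩))

/-- A face that is not split remains a face. -/
theorem isFace_split_of_ne (h : G.IsTriangulation t) (hab : G.HasEdge a b) {f : Finset ℕ}
    (hf : G.IsFace t f) (hne : f ≠ {a, b, t a b}) :
    (G.split x y z).IsFace (splitFace t a b G.order) f := by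
  obtain ⟨u, v, huv, rfl⟩ := hf
  refine ⟨u, v, hasEdge_split.2 (Or.inl huv), ?_⟩
  have hu := h.lt_of_hasEdge huv
  have hv := h.lt_of_hasEdge huv.symm
  obtain ⟨h1, h2, h3, h4, -⟩ := h.face_facts hab
  unfold splitFace
  rw [if_neg hu.ne, if_neg hv.ne, if_neg]
  rintro (⟨rfl, rfl⟩ | ⟨rfl, rfl⟩ | ⟨rfl, rfl⟩)
  · exact hne rfl
  · rw [h3] at hne
    exact hne (by ext; simp; tauto)
  · rw [h4] at hne
    exact hne (by ext; simp; tauto)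

/-- Two vertices of the split face form a new face with the new vertex. -/
theorem isFace_split_new (h : G.IsTriangulation t) (hab : G.HasEdge a b)
    {u v : ℕ} (hu : u ∈ ({a, b, t a b} : Finset ℕ)) (hv : v ∈ ({a, b, t a b} : Finset ℕ))
    (huv : u ≠ v) : (G.split x y z).IsFace (splitFace t a b G.order) {u, v, G.order} := by
  obtain ⟨h1, h2, h3, h4, h5, h6, h7, h8, h9, h10⟩ := h.face_facts hab
  have e1 : splitFace t a b G.order a b = G.order := by unfold splitFace; grind
  have e2 : splitFace t a b G.order b (t a b) = G.order := by unfold splitFace; grind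
  have e3 : splitFace t a b G.order (t a b) a = G.order := by unfold splitFace; grind
  have hall : ∀ p q, G.HasEdge p q → splitFace t a b G.order p q = G.order →
      (G.split x y z).IsFace (splitFace t a b G.order) {p, q, G.order} ∧
        (G.split x y z).IsFace (splitFace t a b G.order) {q, p, G.order} := by
    intro p q hpq he
    have h0 : (G.split x y z).IsFace (splitFace t a b G.order) {p, q, G.order} :=
      ⟨p, q, hasEdge_split.2 (Or.inl hpq), by rw [he]⟩
    exact ⟨h0, by rwa [Finset.insert_comm]⟩
  simp only [Finset.mem_insert, Finset.mem_singleton] at hu hv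
  rcases hu with rfl | rfl | rfl <;> rcases hv with rfl | rfl | rfl
  · exact absurd rfl huv
  · exact (hall _ _ hab e1).1
  · exact (hall _ _ h2 e3).2
  · exact (hall _ _ hab e1).2
  · exact absurd rfl huv
  · exact (hall _ _ h1 e2).1
  · exact (hall _ _ h2 e3).1
  · exact (hall _ _ h1 e2).2
  · exact absurd rfl huv

end IsTriangulation

end GraphData

/-! ### Sequences of splittings -/

namespace GraphData

variable {G : GraphData}

/-- The vertices of a triangle given as a triple. -/
def triangleSet (s : ℕ × ℕ × ℕ) : Finset ℕ := {s.1, s.2.1, s.2.2}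

/-- `G` is a `3`-connected triangulation of the sphere with the listed faces (among others). -/
def HasFaces (G : GraphData) (L : List (ℕ × ℕ × ℕ)) : Prop :=
  ∃ t, G.IsTriangulation t ∧ ∀ s ∈ L, G.IsFace t (triangleSet s)

/-- The degree of a vertex of a graph given as data. -/
def deg (G : GraphData) (v : ℕ) : ℕ := G.edges.countP fun e => e.1 = v ∨ e.2 = v

theorem HasFaces.isPolytopal {L : List (ℕ × ℕ × ℕ)} (h : G.HasFaces L) :
    IsPolytopal G.toGraph := by
  obtain ⟨t, h, -⟩ := h
  exact h.isPolytopal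

theorem IsTriangulation.ncard_neighborSet {t : ℕ → ℕ → ℕ} (h : G.IsTriangulation t)
    (v : Fin G.order) : (G.toGraph.neighborSet v).ncard = G.deg v := by
  classical
  rw [ncard_neighborSet_eq_degree, ← card_neighborFinset_eq_degree, deg,
    List.countP_eq_length_filter, ← List.toFinset_card_of_nodup (h.nodup.filter _)]
  refine Finset.card_bij (fun w _ => if (w : ℕ) < v then ((w : ℕ), (v : ℕ)) else (v, w)) ?_ ?_ ?_
  · intro w hw
    rw [mem_neighborFinset, h.adj_iff] at hw
    simp only [List.mem_toFinset, List.mem_filter, decide_eq_true_eq]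
    rcases hw with hw | hw
    · have := h.lt _ hw
      rw [if_neg (by simp only at this; omega)]
      exact ⟨hw, Or.inl rfl⟩
    · have := h.lt _ hw
      rw [if_pos this.1]
      exact ⟨hw, Or.inr rfl⟩
  · intro w _ w' _ hww'
    ext
    split_ifs at hww' <;> simp only [Prod.mk.injEq] at hww' <;> omega
  · rintro ⟨u, w⟩ he
    simp only [List.mem_toFinset, List.mem_filter, decide_eq_true_eq] at he
    obtain ⟨he, hv⟩ := he
    have hlt := h.lt _ he
    simp only at hlt hv
    rcases hv with rfl | rfl
    · refine ⟨⟨w, hlt.2⟩, ?_, ?_⟩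
      · rw [mem_neighborFinset, h.adj_iff]
        exact Or.inl he
      · simp only
        rw [if_neg (by omega)]
    · refine ⟨⟨u, hlt.1.trans hlt.2⟩, ?_, ?_⟩
      · rw [mem_neighborFinset, h.adj_iff]
        exact Or.inr he
      · simp only
        rw [if_pos hlt.1]

theorem HasFaces.hasDegreesUpTo {L : List (ℕ × ℕ × ℕ)} {n : ℕ} (h : G.HasFaces L)
    (hn : ∀ i, 3 ≤ i → i ≤ n → ∃ v < G.order, G.deg v = i) : HasDegreesUpTo n G.toGraph := by
  obtain ⟨t, h, -⟩ := h
  intro i h3 hi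
  obtain ⟨v, hv, hd⟩ := hn i h3 hi
  exact ⟨⟨v, hv⟩, by rw [h.ncard_neighborSet, hd]⟩

theorem HasFaces.mono {L L' : List (ℕ × ℕ × ℕ)} (h : G.HasFaces L)
    (hL : ∀ s ∈ L', ∃ f ∈ L, triangleSet f = triangleSet s) : G.HasFaces L' := by
  obtain ⟨t, ht, hf⟩ := h
  refine ⟨t, ht, fun s hs => ?_⟩
  obtain ⟨f, hfL, hfs⟩ := hL s hs
  exact hfs ▸ hf f hfL

/-- The faces obtained from `L` when the triangle `s` is split by the vertex `m`. -/
def facesAfterSplit (L : List (ℕ × ℕ × ℕ)) (m : ℕ) (s : ℕ × ℕ × ℕ) : List (ℕ × ℕ × ℕ) :=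
  (s.1, s.2.1, m) :: (s.1, s.2.2, m) :: (s.2.1, s.2.2, m) ::
    L.filter fun f => triangleSet f ≠ triangleSet s

theorem HasFaces.lt {L : List (ℕ × ℕ × ℕ)} (h : G.HasFaces L) {s : ℕ × ℕ × ℕ} (hs : s ∈ L) :
    ∀ v ∈ triangleSet s, v < G.order := by
  obtain ⟨t, ht, hf⟩ := h
  obtain ⟨a, b, hab, he⟩ := hf s hs
  obtain ⟨-, -, -, -, -, -, -, h8, h9, h10⟩ := ht.face_facts hab
  rw [he]
  simp [h8, h9, h10]

theorem HasFaces.deg_eq_zero {L : List (ℕ × ℕ × ℕ)} (h : G.HasFaces L) : G.deg G.order = 0 := by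
  obtain ⟨t, ht, -⟩ := h
  rw [deg, List.countP_eq_zero]
  intro e he
  have := ht.lt e he
  simp only [decide_eq_true_eq]
  omega

theorem HasFaces.ne {L : List (ℕ × ℕ × ℕ)} (h : G.HasFaces L) {a b c : ℕ}
    (hs : ∃ f ∈ L, triangleSet f = triangleSet (a, b, c)) : a ≠ b ∧ a ≠ c ∧ b ≠ c := by
  obtain ⟨t, ht, hf⟩ := h
  obtain ⟨f, hfL, hfs⟩ := hs
  obtain ⟨p, q, hpq, he⟩ := hf f hfL
  obtain ⟨-, -, -, -, h5, h6, h7, -⟩ := ht.face_facts hpq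
  rw [hfs] at he
  have hcard : (triangleSet (a, b, c)).card = 3 := by
    rw [he]
    exact Finset.card_eq_three.2 ⟨p, q, t p q, h5, h7.symm, h6, rfl⟩
  simp only [triangleSet] at hcard
  refine ⟨?_, ?_, ?_⟩ <;> rintro rfl <;> revert hcard
  · rw [Finset.insert_eq_of_mem (by simp)]
    exact fun hc => absurd (Finset.card_le_two (a := a) (b := c)) (by omega)
  · rw [Finset.insert_eq_of_mem (by simp)]
    exact fun hc => absurd (Finset.card_le_two (a := b) (b := a)) (by omega)
  · rw [Finset.pair_eq_singleton]
    exact fun hc => absurd (Finset.card_le_two (a := a) (b := b)) (by omega)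

theorem HasFaces.split {L : List (ℕ × ℕ × ℕ)} (h : G.HasFaces L) {s : ℕ × ℕ × ℕ}
    (hs : ∃ f ∈ L, triangleSet f = triangleSet s) :
    (G.split s.1 s.2.1 s.2.2).HasFaces (facesAfterSplit L G.order s) := by
  obtain ⟨hne1, hne2, hne3⟩ := h.ne hs
  obtain ⟨t, ht, hf⟩ := h
  obtain ⟨f, hfL, hfs⟩ := hs
  obtain ⟨a, b, hab, he⟩ := hf f hfL
  rw [hfs] at he
  refine ⟨_, ht.split hab he, ?_⟩
  have hmem : ∀ u, u ∈ triangleSet s → u ∈ ({a, b, t a b} : Finset ℕ) := fun u hu => he ▸ hu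
  have m1 := hmem s.1 (by simp [triangleSet])
  have m2 := hmem s.2.1 (by simp [triangleSet])
  have m3 := hmem s.2.2 (by simp [triangleSet])
  intro g hg
  simp only [facesAfterSplit, List.mem_cons, List.mem_filter, decide_eq_true_eq] at hg
  rcases hg with rfl | rfl | rfl | ⟨hg, hgs⟩
  · exact ht.isFace_split_new hab m1 m2 hne1
  · exact ht.isFace_split_new hab m1 m3 hne2
  · exact ht.isFace_split_new hab m2 m3 hne3
  · exact ht.isFace_split_of_ne hab (hf g hg) (he ▸ hgs)

theorem HasFaces.deg_split {L : List (ℕ × ℕ × ℕ)} (h : G.HasFaces L) {s : ℕ × ℕ × ℕ}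
    (hs : ∃ f ∈ L, triangleSet f = triangleSet s) {v : ℕ} (hv : v < G.order) :
    (G.split s.1 s.2.1 s.2.2).deg v = G.deg v + if v ∈ triangleSet s then 1 else 0 := by
  obtain ⟨hne1, hne2, hne3⟩ := h.ne hs
  simp only [deg, GraphData.split, List.countP_cons, hv.ne', or_false, triangleSet,
    Finset.mem_insert, Finset.mem_singleton, decide_eq_true_eq]
  grind

theorem HasFaces.deg_split_order {L : List (ℕ × ℕ × ℕ)} (h : G.HasFaces L) (a b c : ℕ) :
    (G.split a b c).deg G.order = 3 := by
  have := h.deg_eq_zero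
  simp only [deg] at this
  simp only [deg, GraphData.split, List.countP_cons, this]
  simp

/-! Long sequences of splittings are treated by computation with labels in place of vertices. -/

/-- The faces (among those obtained from `L`) after the triangles in the list have been split by
the vertices `m, m + 1, …`. -/
def facesAfter (L : List (ℕ × ℕ × ℕ)) (m : ℕ) : List (ℕ × ℕ × ℕ) → List (ℕ × ℕ × ℕ)
  | [] => L
  | s :: S => facesAfter (facesAfterSplit L m s) (m + 1) S

/-- Every triangle in the list is a face at the time when it is split. -/
def splitsFaces (L : List (ℕ × ℕ × ℕ)) (m : ℕ) : List (ℕ × ℕ × ℕ) → Bool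
  | [] => true
  | s :: S => (L.any fun f => triangleSet f = triangleSet s) &&
      splitsFaces (facesAfterSplit L m s) (m + 1) S

/-- Vertices for labels. -/
def relabel (ρ : ℕ → ℕ) (s : ℕ × ℕ × ℕ) : ℕ × ℕ × ℕ := (ρ s.1, ρ s.2.1, ρ s.2.2)

theorem triangleSet_relabel (ρ : ℕ → ℕ) (s : ℕ × ℕ × ℕ) :
    triangleSet (relabel ρ s) = (triangleSet s).image ρ := by
  simp [triangleSet, relabel, Finset.image_insert]

theorem map_facesAfterSplit {ρ : ℕ → ℕ} (hρ : ρ.Injective) (L : List (ℕ × ℕ × ℕ)) (m : ℕ)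
    (s : ℕ × ℕ × ℕ) : facesAfterSplit (L.map (relabel ρ)) (ρ m) (relabel ρ s) =
      (facesAfterSplit L m s).map (relabel ρ) := by
  have hfilter : (L.map (relabel ρ)).filter
      (fun f => triangleSet f ≠ triangleSet (relabel ρ s)) =
      (L.filter fun f => triangleSet f ≠ triangleSet s).map (relabel ρ) := by
    rw [List.filter_map]
    congr 2
    ext f
    simp [triangleSet_relabel, (Finset.image_injective hρ).eq_iff]
  unfold facesAfterSplit
  rw [hfilter]
  rfl

/-- The labels below `m` stand for vertices of `G`, the labels from `m` on for the vertices that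
will be added. -/
structure IsLabelling (G : GraphData) (ρ : ℕ → ℕ) (m : ℕ) : Prop where
  inj : ρ.Injective
  lt : ∀ i < m, ρ i < G.order
  new : ∀ j, ρ (m + j) = G.order + j

theorem IsLabelling.split {ρ : ℕ → ℕ} {m : ℕ} (h : G.IsLabelling ρ m) (a b c : ℕ) :
    (G.split a b c).IsLabelling ρ (m + 1) := by
  refine ⟨h.inj, fun i hi => ?_, fun j => ?_⟩
  · rw [order_split]
    rcases Nat.lt_succ_iff_lt_or_eq.1 hi with hi | rfl
    · exact (h.lt i hi).trans (Nat.lt_succ_self _)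
    · have := h.new 0
      rw [add_zero, add_zero] at this
      omega
  · rw [order_split, add_assoc, h.new, ← add_assoc]

/-- The faces and degrees after a sequence of splittings: each triangle adds `1` to the degrees of
its vertices, which start from `3` for the vertices that are added. -/
theorem HasFaces.splitAll {ρ : ℕ → ℕ} (S : List (ℕ × ℕ × ℕ)) {L : List (ℕ × ℕ × ℕ)} {m : ℕ}
    {G : GraphData} (h : G.HasFaces (L.map (relabel ρ))) (hρ : G.IsLabelling ρ m)
    (hS : splitsFaces L m S = true) :
    (G.splitAll (S.map (relabel ρ))).HasFaces ((facesAfter L m S).map (relabel ρ)) ∧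
      (∀ i < m, (G.splitAll (S.map (relabel ρ))).deg (ρ i) =
        G.deg (ρ i) + S.countP fun s => i ∈ triangleSet s) ∧
      (∀ i, m ≤ i → i < m + S.length → (G.splitAll (S.map (relabel ρ))).deg (ρ i) =
        3 + S.countP fun s => i ∈ triangleSet s) ∧
      ∀ v < G.order, (∀ i < m, v ≠ ρ i) → (G.splitAll (S.map (relabel ρ))).deg v = G.deg v := by
  induction S generalizing L m G with
  | nil =>
    refine ⟨h, fun i _ => rfl, fun i h1 h2 => ?_, fun v _ _ => rfl⟩
    rw [List.length_nil] at h2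
    omega
  | cons s S ih =>
    simp only [splitsFaces, Bool.and_eq_true, List.any_eq_true, decide_eq_true_eq] at hS
    obtain ⟨⟨f, hf, hfs⟩, hS⟩ := hS
    have hs : ∃ f ∈ L.map (relabel ρ), triangleSet f = triangleSet (relabel ρ s) :=
      ⟨_, List.mem_map_of_mem hf, by rw [triangleSet_relabel, triangleSet_relabel, hfs]⟩
    have hm : ρ m = G.order := hρ.new 0
    have hslt : ∀ v ∈ triangleSet (relabel ρ s), v < G.order := by
      obtain ⟨g, hg, hgs⟩ := hs
      rw [← hgs]
      exact h.lt hg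
    have hmem : ∀ i, ρ i ∈ triangleSet (relabel ρ s) ↔ i ∈ triangleSet s := by
      intro i
      rw [triangleSet_relabel, hρ.inj.mem_finset_image]
    have h' := h.split hs
    rw [← hm, map_facesAfterSplit hρ.inj] at h'
    obtain ⟨h1, h3, h4, h5⟩ := ih h' (hρ.split _ _ _) hS
    have hGs : G.splitAll ((s :: S).map (relabel ρ)) =
      (G.split (relabel ρ s).1 (relabel ρ s).2.1 (relabel ρ s).2.2).splitAll
        (S.map (relabel ρ)) := rfl
    rw [hGs]
    refine ⟨h1, ?_, ?_, ?_⟩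
    · intro i hi
      rw [List.countP_cons]
      refine (h3 i (by omega)).trans ?_
      have := h.deg_split hs (hρ.lt i hi)
      simp only [hmem] at this
      rw [this]
      simp only [decide_eq_true_eq]
      ring
    · intro i hi hi'
      have hnot : i ∉ triangleSet s := by
        rw [← hmem]
        intro hmem'
        have h6 := hslt _ hmem'
        obtain ⟨j, rfl⟩ := Nat.exists_eq_add_of_le hi
        have h7 := hρ.new j
        omega
      rw [List.countP_cons_of_neg (by simpa using hnot)]
      rw [List.length_cons] at hi'
      rcases hi.eq_or_lt with rfl | hlt
      · rw [h3 m (by omega), hm]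
        congr 1
        exact h.deg_split_order _ _ _
      · exact h4 i hlt (by omega)
    · intro v hv hvi
      refine (h5 v (hv.trans (Nat.lt_succ_self _)) ?_).trans ?_
      · intro i hi
        rcases Nat.lt_succ_iff_lt_or_eq.1 hi with hi | rfl
        · exact hvi i hi
        · omega
      · have hnot : v ∉ triangleSet (relabel ρ s) := by
          rw [triangleSet_relabel, Finset.mem_image]
          rintro ⟨i, hi, rfl⟩
          have h6 := hslt _ ((hmem i).2 hi)
          by_cases him : i < m
          · exact hvi i him rfl
          · obtain ⟨j, rfl⟩ := Nat.exists_eq_add_of_le (not_lt.1 him)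
            have h7 := hρ.new j
            omega
        have := h.deg_split hs hv
        rw [if_neg hnot, add_zero] at this
        exact this

theorem HasFaces.hSplit {G : GraphData} {L : List (ℕ × ℕ × ℕ)} {a b c : ℕ}
    (h : G.HasFaces ((a, b, c) :: L)) (hL : ∀ f ∈ L, triangleSet f ≠ triangleSet (a, b, c))
    (k : ℕ) :
    (G.hSplit a b c k).HasFaces L ∧
      ∀ v < G.order, (G.hSplit a b c k).deg v =
        G.deg v + if v = a ∨ v = b then k else if v = c then min k 1 else 0 := by
  induction k generalizing G c with
  | zero =>
    refine ⟨h.mono fun s hs => ⟨s, List.mem_cons_of_mem _ hs, rfl⟩, fun v _ => ?_⟩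
    simp [GraphData.hSplit]
  | succ k ih =>
    have hs : ∃ f ∈ (a, b, c) :: L, triangleSet f = triangleSet (a, b, c) :=
      ⟨_, List.mem_cons_self, rfl⟩
    have hlt := h.lt (s := (a, b, c)) List.mem_cons_self
    have hLlt : ∀ f ∈ L, ∀ v ∈ triangleSet f, v < G.order := fun f hf =>
      h.lt (List.mem_cons_of_mem _ hf)
    have hne := h.ne hs
    have h' : (G.split a b c).HasFaces ((a, b, G.order) :: L) := by
      refine (h.split hs).mono fun s hs => ⟨s, ?_, rfl⟩
      rcases List.mem_cons.1 hs with rfl | hs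
      · simp [facesAfterSplit]
      · have := hL s hs
        simp [facesAfterSplit, hs, this]
    obtain ⟨h1, h3⟩ := ih h' fun f hf he => by
      have := hLlt f hf G.order (he ▸ by simp [triangleSet])
      omega
    refine ⟨h1, fun v hv => ?_⟩
    · refine (h3 v (hv.trans (Nat.lt_succ_self _))).trans ?_
      have h4 := h.deg_split hs hv
      simp only at h4
      rw [h4]
      simp only [triangleSet, Finset.mem_insert, Finset.mem_singleton]
      have hmin : min (k + 1) 1 = 1 := by omega
      rw [hmin]
      grind

theorem order_splitAll (S : List (ℕ × ℕ × ℕ)) (G : GraphData) :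
    (G.splitAll S).order = G.order + S.length := by
  induction S generalizing G with
  | nil => rfl
  | cons s S ih =>
    refine (ih _).trans ?_
    rw [order_split, List.length_cons]
    ring

theorem order_hSplit (a b c k : ℕ) (G : GraphData) :
    (G.hSplit a b c k).order = G.order + k := by
  induction k generalizing G c with
  | zero => rfl
  | succ k ih =>
    refine (ih _ _).trans ?_
    rw [order_split]
    ring

theorem HasFaces.mono_relabel {ρ : ℕ → ℕ} {L L' : List (ℕ × ℕ × ℕ)}
    (h : G.HasFaces (L.map (relabel ρ)))
    (hL : ∀ s ∈ L', ∃ f ∈ L, triangleSet f = triangleSet s) : G.HasFaces (L'.map (relabel ρ)) := by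
  refine h.mono fun s hs => ?_
  obtain ⟨s', hs', rfl⟩ := List.mem_map.1 hs
  obtain ⟨f, hf, hfs⟩ := hL s' hs'
  exact ⟨_, List.mem_map_of_mem hf, by rw [triangleSet_relabel, triangleSet_relabel, hfs]⟩

theorem HasFaces.hSplit_relabel {ρ : ℕ → ℕ} (hρ : ρ.Injective) {L : List (ℕ × ℕ × ℕ)}
    {a b c : ℕ} (h : G.HasFaces (((a, b, c) :: L).map (relabel ρ)))
    (hL : ∀ f ∈ L, triangleSet f ≠ triangleSet (a, b, c)) (k : ℕ) :
    (G.hSplit (ρ a) (ρ b) (ρ c) k).HasFaces (L.map (relabel ρ)) ∧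
      (∀ i, ρ i < G.order → (G.hSplit (ρ a) (ρ b) (ρ c) k).deg (ρ i) =
        G.deg (ρ i) + if i = a ∨ i = b then k else if i = c then min k 1 else 0) ∧
      ∀ v < G.order, (∀ i, v ≠ ρ i) → (G.hSplit (ρ a) (ρ b) (ρ c) k).deg v = G.deg v := by
  obtain ⟨h1, h2⟩ := HasFaces.hSplit (a := ρ a) (b := ρ b) (c := ρ c) h (fun f hf => by
    obtain ⟨f', hf', rfl⟩ := List.mem_map.1 hf
    have h3 := (Finset.image_injective hρ).ne (hL f' hf')
    rwa [← triangleSet_relabel, ← triangleSet_relabel] at h3) k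
  refine ⟨h1, fun i hi => ?_, fun v hv hvi => ?_⟩
  · rw [h2 _ hi]
    simp only [hρ.eq_iff]
  · rw [h2 v hv]
    simp [hvi]

end GraphData

/-! ### The tetrahedron and small graphs -/

namespace GraphData

/-- The tetrahedron. -/
def tetrahedron : GraphData := triangle.split 2 1 0

/-- The faces of the tetrahedron. -/
def tetrahedronFaces : List (ℕ × ℕ × ℕ) := [(0, 1, 2), (0, 1, 3), (0, 2, 3), (1, 2, 3)]

theorem hasEdge_tetrahedron {u v : ℕ} :
    tetrahedron.HasEdge u v ↔ u < 4 ∧ v < 4 ∧ u ≠ v := by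
  refine ⟨fun h => ?_, ?_⟩
  · have h' : ∀ e ∈ tetrahedron.edges, e.1 < 4 ∧ e.2 < 4 ∧ e.1 ≠ e.2 := by decide
    rcases h with h | h
    · exact h' _ h
    · exact ⟨(h' _ h).2.1, (h' _ h).1, (h' _ h).2.2.symm⟩
  · rintro ⟨hu, hv, huv⟩
    have h : ∀ u v : Fin 4, (u : ℕ) ≠ v →
        ((u : ℕ), (v : ℕ)) ∈ tetrahedron.edges ∨ ((v : ℕ), (u : ℕ)) ∈ tetrahedron.edges := by
      decide
    exact h ⟨u, hu⟩ ⟨v, hv⟩ huv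

theorem hasFaces_tetrahedron : tetrahedron.HasFaces tetrahedronFaces := by
  let t : ℕ → ℕ → ℕ := fun u v =>
    [0, 2, 3, 1, 3, 0, 0, 2, 1, 3, 0, 0, 2, 0, 1, 0].getD (4 * u + v) 0
  have h1 : ∀ u < 4, ∀ v < 4, u ≠ v → t u v < 4 ∧ v ≠ t u v ∧ t v (t u v) = u := by decide
  have h2 : ∀ v x y : Fin 4, v ≠ x → v ≠ y →
      (y : ℕ) = x ∨ (y : ℕ) = t x v ∨ (y : ℕ) = t (t x v) v := by decide
  have h3 : ∀ s ∈ tetrahedronFaces, ∃ a < 4, ∃ b < 4, a ≠ b ∧ triangleSet s = {a, b, t a b} := by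
    decide
  refine ⟨t, ⟨by decide, by decide, by decide, by decide, ?_, ?_, ?_⟩, ?_⟩
  · intro u v huv
    rw [hasEdge_tetrahedron] at huv ⊢
    obtain ⟨h4, h5, h6⟩ := h1 u huv.1 v huv.2.1 huv.2.2
    exact ⟨⟨huv.2.1, h4, h5⟩, h6⟩
  · intro v x y hx hy
    rw [hasEdge_tetrahedron] at hx hy
    rcases h2 ⟨v, hx.1⟩ ⟨x, hx.2.1⟩ ⟨y, hy.2.1⟩ (fun h => hx.2.2 (congrArg Fin.val h))
      (fun h => hy.2.2 (congrArg Fin.val h)) with h | h | h <;> simp only at h <;> subst h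
    · exact .refl
    · exact .single rfl
    · exact .tail (.single rfl) rfl
  · have hadj : ∀ u v : Fin tetrahedron.order, u ≠ v → tetrahedron.toGraph.Adj u v :=
      fun u v huv => (fromRel_adj _ _ _).2
        ⟨huv, hasEdge_tetrahedron.2 ⟨u.2, v.2, fun h => huv (Fin.ext h)⟩⟩
    have hcard : Nat.card (Fin tetrahedron.order) = 4 := by
      rw [Nat.card_eq_fintype_card, Fintype.card_fin]
      rfl
    refine ⟨hcard.ge, fun S hS => (connected_iff _).2 ⟨?_, ?_⟩⟩
    · rintro ⟨u, hu⟩ ⟨v, hv⟩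
      by_cases huv : u = v
      · subst huv
        exact .refl _
      · have : (tetrahedron.toGraph.induce {v | v ∉ S}).Adj ⟨u, hu⟩ ⟨v, hv⟩ := hadj u v huv
        exact this.reachable
    · obtain ⟨u, -, hu⟩ := Finset.exists_mem_notMem_of_card_lt_card (s := S) (t := Finset.univ)
        (by rw [Finset.card_univ, ← Nat.card_eq_fintype_card, hcard]; omega)
      exact ⟨⟨u, hu⟩⟩
  · intro s hs
    obtain ⟨a, ha, b, hb, hab, he⟩ := h3 s hs
    exact ⟨a, b, hasEdge_tetrahedron.2 ⟨ha, hb, hab⟩, he⟩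

theorem hasFaces_tetrahedron_splitAll {S : List (ℕ × ℕ × ℕ)}
    (hS : splitsFaces tetrahedronFaces 4 S = true) :
    (tetrahedron.splitAll S).HasFaces (facesAfter tetrahedronFaces 4 S) := by
  have hid : ∀ L : List (ℕ × ℕ × ℕ), L.map (relabel id) = L := fun L => List.map_id L
  have h := (HasFaces.splitAll (G := tetrahedron) (ρ := id) S (L := tetrahedronFaces) (m := 4)
    (by rw [hid]; exact hasFaces_tetrahedron)
    ⟨Function.injective_id, fun i hi => hi, fun j => rfl⟩ hS).1
  rwa [hid, hid] at h

theorem HasFaces.order_mem_polytopalOrders {G : GraphData} {L : List (ℕ × ℕ × ℕ)} {n : ℕ}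
    (h : G.HasFaces L) (hn : ∀ i, 3 ≤ i → i ≤ n → ∃ v < G.order, G.deg v = i) :
    G.order ∈ polytopalOrders n :=
  ⟨G.toGraph, h.isPolytopal, h.hasDegreesUpTo hn⟩

theorem mem_polytopalOrders_of_splits (S : List (ℕ × ℕ × ℕ)) {n p : ℕ}
    (hS : splitsFaces tetrahedronFaces 4 S = true) (hp : 4 + S.length = p)
    (hdeg : ∀ i ∈ Finset.Icc 3 n, ∃ v < p, (tetrahedron.splitAll S).deg v = i) :
    p ∈ polytopalOrders n := by
  have ho : (tetrahedron.splitAll S).order = p := (order_splitAll S _).trans hp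
  have h := (hasFaces_tetrahedron_splitAll hS).order_mem_polytopalOrders (n := n)
    fun i h3 hi => by
      rw [ho]
      exact hdeg i (Finset.mem_Icc.2 ⟨h3, hi⟩)
  rwa [ho] at h

end GraphData

open GraphData

theorem four_mem_polytopalOrders : 4 ∈ polytopalOrders 3 :=
  mem_polytopalOrders_of_splits [] (by decide) rfl (by decide)

theorem five_mem_polytopalOrders : 5 ∈ polytopalOrders 4 :=
  mem_polytopalOrders_of_splits [(0, 1, 3)] (by decide) rfl (by decide)

theorem six_mem_polytopalOrders : 6 ∈ polytopalOrders 5 :=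
  mem_polytopalOrders_of_splits [(1, 2, 3), (0, 1, 3)] (by decide) rfl (by decide)

theorem seven_mem_polytopalOrders : 7 ∈ polytopalOrders 6 :=
  mem_polytopalOrders_of_splits [(1, 2, 3), (0, 2, 3), (1, 2, 4)] (by decide) rfl (by decide)

theorem eight_mem_polytopalOrders : 8 ∈ polytopalOrders 7 :=
  mem_polytopalOrders_of_splits [(1, 2, 3), (1, 3, 4), (3, 4, 5), (1, 3, 5)]
    (by decide) rfl (by decide)

theorem ten_mem_polytopalOrders : 10 ∈ polytopalOrders 8 :=
  mem_polytopalOrders_of_splits [(1, 2, 3), (2, 3, 4), (1, 2, 4), (2, 3, 5), (3, 4, 5), (3, 5, 7)]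
    (by decide +kernel) rfl (by decide +kernel)

theorem eleven_mem_polytopalOrders : 11 ∈ polytopalOrders 9 :=
  mem_polytopalOrders_of_splits
    [(1, 2, 3), (1, 3, 4), (1, 2, 4), (0, 2, 3), (2, 3, 4), (2, 3, 8), (2, 4, 8)]
    (by decide +kernel) rfl (by decide +kernel)

theorem fourteen_mem_polytopalOrders : 14 ∈ polytopalOrders 10 :=
  mem_polytopalOrders_of_splits
    [(0, 1, 2), (1, 2, 3), (1, 3, 5), (0, 2, 3), (1, 2, 5), (2, 3, 7), (3, 7, 9), (0, 2, 4),
      (0, 3, 7), (1, 3, 6)]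
    (by decide +kernel) rfl (by decide +kernel)

theorem sixteen_mem_polytopalOrders : 16 ∈ polytopalOrders 11 :=
  mem_polytopalOrders_of_splits
    [(0, 2, 3), (1, 2, 3), (0, 2, 4), (2, 3, 4), (1, 3, 5), (3, 5, 8), (1, 5, 8), (3, 4, 7),
      (2, 3, 5), (1, 2, 5), (0, 1, 2), (0, 1, 3)]
    (by decide +kernel) rfl (by decide +kernel)

theorem nineteen_mem_polytopalOrders : 19 ∈ polytopalOrders 12 :=
  mem_polytopalOrders_of_splits
    [(0, 1, 2), (1, 2, 3), (1, 2, 5), (1, 3, 5), (0, 1, 3), (1, 2, 4), (0, 2, 3), (0, 3, 10),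
      (0, 3, 11), (0, 10, 11), (0, 11, 12), (2, 3, 5), (0, 2, 10), (3, 10, 11), (3, 11, 12)]
    (by decide +kernel) rfl (by decide +kernel)

theorem twentythree_mem_polytopalOrders : 23 ∈ polytopalOrders 13 :=
  mem_polytopalOrders_of_splits
    [(0, 1, 2), (1, 2, 4), (1, 2, 3), (1, 3, 6), (0, 1, 4), (0, 2, 3), (2, 4, 5), (2, 3, 6),
      (2, 3, 9), (0, 2, 4), (4, 5, 10), (1, 6, 7), (1, 3, 7), (6, 7, 15), (3, 6, 11), (1, 4, 5),
      (3, 6, 7), (1, 2, 6), (1, 7, 15)]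
    (by decide +kernel) rfl (by decide +kernel)

/-- The algorithm gives no graph for `n = 15`. -/
theorem thirtyone_mem_polytopalOrders : 31 ∈ polytopalOrders 15 :=
  mem_polytopalOrders_of_splits
    [(0, 1, 2), (0, 2, 4), (0, 2, 3), (0, 4, 5), (1, 2, 4), (0, 2, 5), (0, 5, 7), (2, 4, 5),
      (2, 4, 8), (0, 5, 10), (0, 7, 10), (5, 7, 10), (2, 5, 11), (0, 1, 3), (1, 3, 17), (4, 5, 7),
      (0, 4, 7), (0, 1, 4), (1, 2, 8), (1, 2, 3), (5, 10, 15), (5, 7, 15), (1, 2, 23), (1, 8, 22),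
      (10, 15, 24), (0, 3, 17), (7, 10, 15)]
    (by decide +kernel) rfl (by decide +kernel)

/-! ### The stages of the algorithm -/

/-- The labels `0, 1, 2, 3` stand for the marked vertices of a stage, the labels from `4` on for
the vertices that will be added. -/
def Stage.label (s : Stage) : ℕ → ℕ
  | 0 => s.u
  | 1 => s.v
  | 2 => s.w
  | 3 => s.x
  | i + 4 => s.graph.order + i

/-- The invariant of the algorithm: a triangulation in which the marked vertex `x` is the common
vertex of three faces formed with `u, v, w`, the marked vertices have degrees `10, 8, 6, 3`, and
every other degree from `3` to `n` is the degree of an unmarked vertex. -/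
structure Stage.IsGood (s : Stage) (n : ℕ) : Prop where
  faces : s.graph.HasFaces [(s.u, s.v, s.x), (s.u, s.w, s.x), (s.v, s.w, s.x)]
  deg_u : s.graph.deg s.u = 10
  deg_v : s.graph.deg s.v = 8
  deg_w : s.graph.deg s.w = 6
  deg_x : s.graph.deg s.x = 3
  deg : ∀ i, 3 ≤ i → i ≤ n → i ≠ 6 → i ≠ 8 → i ≠ 10 →
    ∃ y < s.graph.order, y ≠ s.u ∧ y ≠ s.v ∧ y ≠ s.w ∧ y ≠ s.x ∧ s.graph.deg y = i

namespace Stage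

variable {s : Stage} {n : ℕ}

theorem IsGood.lt (h : s.IsGood n) : s.u < s.graph.order ∧ s.v < s.graph.order ∧
    s.w < s.graph.order ∧ s.x < s.graph.order := by
  have h1 := h.faces.lt (s := (s.u, s.v, s.x)) (by simp)
  have h2 := h.faces.lt (s := (s.u, s.w, s.x)) (by simp)
  simp only [triangleSet, Finset.mem_insert, Finset.mem_singleton, forall_eq_or_imp,
    forall_eq] at h1 h2
  exact ⟨h1.1, h1.2.1, h2.2.1, h1.2.2⟩

/-- The marked vertices are distinct as they have different degrees. -/
theorem IsGood.isLabelling (h : s.IsGood n) : s.graph.IsLabelling s.label 4 := by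
  obtain ⟨hu, hv, hw, hx⟩ := h.lt
  have du := h.deg_u
  have dv := h.deg_v
  have dw := h.deg_w
  have dx := h.deg_x
  have huv : s.u ≠ s.v := fun e => by rw [e] at du; omega
  have huw : s.u ≠ s.w := fun e => by rw [e] at du; omega
  have hux : s.u ≠ s.x := fun e => by rw [e] at du; omega
  have hvw : s.v ≠ s.w := fun e => by rw [e] at dv; omega
  have hvx : s.v ≠ s.x := fun e => by rw [e] at dv; omega
  have hwx : s.w ≠ s.x := fun e => by rw [e] at dw; omega
  refine ⟨?_, ?_, fun j => by rw [add_comm 4 j]; rfl⟩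
  · intro i j hij
    match i, j with
    | 0, 0 | 1, 1 | 2, 2 | 3, 3 => rfl
    | 0, 1 => exact absurd hij huv
    | 0, 2 => exact absurd hij huw
    | 0, 3 => exact absurd hij hux
    | 1, 0 => exact absurd hij.symm huv
    | 1, 2 => exact absurd hij hvw
    | 1, 3 => exact absurd hij hvx
    | 2, 0 => exact absurd hij.symm huw
    | 2, 1 => exact absurd hij.symm hvw
    | 2, 3 => exact absurd hij hwx
    | 3, 0 => exact absurd hij.symm hux
    | 3, 1 => exact absurd hij.symm hvx
    | 3, 2 => exact absurd hij.symm hwx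
    | 0, j + 4 | 1, j + 4 | 2, j + 4 | 3, j + 4 => simp only [label] at hij; omega
    | i + 4, 0 | i + 4, 1 | i + 4, 2 | i + 4, 3 => simp only [label] at hij; omega
    | i + 4, j + 4 => simp only [label] at hij; omega
  · intro i hi
    match i with
    | 0 => exact hu
    | 1 => exact hv
    | 2 => exact hw
    | 3 => exact hx

theorem ne_label {y : ℕ} (hy : y < s.graph.order) (hu : y ≠ s.u) (hv : y ≠ s.v) (hw : y ≠ s.w)
    (hx : y ≠ s.x) (i : ℕ) : y ≠ s.label i := by
  match i with
  | 0 => exact hu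
  | 1 => exact hv
  | 2 => exact hw
  | 3 => exact hx
  | i + 4 => simp only [label]; omega

theorem isGood_stage14 : stage14.IsGood 14 := by
  have h := hasFaces_tetrahedron_splitAll (S := [(3, 2, 1), (4, 3, 2), (5, 4, 3), (6, 5, 4),
    (7, 6, 5), (0, 1, 3), (1, 2, 4),
    (0, 1, 2), (0, 2, 3), (1, 3, 4), (2, 3, 5), (2, 4, 5), (3, 4, 6), (3, 5, 6),
    (4, 5, 7), (4, 6, 7), (5, 6, 8), (5, 7, 8), (6, 7, 8),
    (0, 3, 9), (1, 4, 10), (2, 4, 10)]) (by decide +kernel)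
  refine ⟨HasFaces.mono (G := stage14.graph) h (by decide +kernel), by decide +kernel,
    by decide +kernel, by decide +kernel, by decide +kernel, ?_⟩
  have hdeg : ∀ i ∈ Finset.Icc 3 14, i ≠ 6 → i ≠ 8 → i ≠ 10 → ∃ y ∈ Finset.range 26,
      (y ≠ 6 ∧ y ≠ 7 ∧ y ≠ 8 ∧ y ≠ 22) ∧ stage14.graph.deg y = i := by decide +kernel
  intro i h3 hi h6 h8 h10
  obtain ⟨y, hy, ⟨h1, h2, h3, h4⟩, h5⟩ := hdeg i (Finset.mem_Icc.2 ⟨h3, hi⟩) h6 h8 h10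
  exact ⟨y, Finset.mem_range.1 hy, h1, h2, h3, h4, h5⟩

/-- The triangles split by the piece, in labels. -/
def pieceSplits : List (ℕ × ℕ × ℕ) :=
  [(1, 2, 3), (2, 3, 4), (3, 4, 5), (0, 1, 3), (0, 2, 3), (1, 3, 4), (1, 2, 4), (2, 4, 5),
    (2, 3, 5), (3, 5, 6), (3, 4, 6), (4, 5, 6)]

/-- With `n = 14 + 4 k`, the old vertices `u, v, w, x` get the degrees `n + 4, n + 2, n + 1, n + 3`,
and the new marked vertices the degrees `10, 8, 6, 3`; the degrees of the other old vertices do not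
change. -/
theorem IsGood.addPiece {k : ℕ} (h : s.IsGood (14 + 4 * k)) :
    (s.addPiece (k + 1)).IsGood (14 + 4 * (k + 1)) := by
  have hρ := h.isLabelling
  have hinj := hρ.inj
  obtain ⟨hu, hv, hw, hx⟩ := h.lt
  obtain ⟨f0, d0, e0, g0⟩ := HasFaces.splitAll pieceSplits (L := [(0, 1, 3), (0, 2, 3), (1, 2, 3)])
    h.faces hρ (by decide +kernel)
  set G₀ := s.graph.splitAll (pieceSplits.map (relabel s.label)) with hG₀
  have o0 : G₀.order = s.graph.order + 12 := order_splitAll _ _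
  have f0' := f0.mono_relabel (L' := [(0, 1, 7), (0, 3, 8), (2, 3, 8), (4, 5, 15), (4, 6, 15),
    (5, 6, 15)]) (by decide +kernel)
  obtain ⟨f1, d1, g1⟩ := HasFaces.hSplit_relabel hinj f0' (by decide) (4 * (k + 1))
  set G₁ := G₀.hSplit (s.label 0) (s.label 1) (s.label 7) (4 * (k + 1)) with hG₁
  have o1 : G₁.order = G₀.order + 4 * (k + 1) := order_hSplit _ _ _ _ _
  obtain ⟨f2, d2, g2⟩ := HasFaces.hSplit_relabel hinj f1 (by decide) 2
  set G₂ := G₁.hSplit (s.label 0) (s.label 3) (s.label 8) 2 with hG₂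
  have o2 : G₂.order = G₁.order + 2 := order_hSplit _ _ _ _ _
  obtain ⟨f3, d3, g3⟩ := HasFaces.hSplit_relabel hinj f2 (by decide) (4 * (k + 1) - 1)
  set G₃ := G₂.hSplit (s.label 2) (s.label 3) (s.label 8) (4 * (k + 1) - 1) with hG₃
  have o3 : G₃.order = G₂.order + (4 * (k + 1) - 1) := order_hSplit _ _ _ _ _
  have hG : (s.addPiece (k + 1)).graph = G₃ := rfl
  have hlt : ∀ i < 16, s.label i < G₀.order := by
    intro i hi
    by_cases h4 : i < 4
    · exact (hρ.lt i h4).trans (by omega)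
    · obtain ⟨j, rfl⟩ := Nat.exists_eq_add_of_le (not_lt.1 h4)
      rw [hρ.new, o0]
      omega
  have hdeg : ∀ i < 16, G₃.deg (s.label i) = G₀.deg (s.label i) +
      (if i = 0 ∨ i = 1 then 4 * (k + 1) else if i = 7 then 1 else 0) +
      (if i = 0 ∨ i = 3 then 2 else if i = 8 then 1 else 0) +
      (if i = 2 ∨ i = 3 then 4 * (k + 1) - 1 else if i = 8 then 1 else 0) := by
    intro i hi
    have := hlt i hi
    rw [d3 i (by omega), d2 i (by omega), d1 i (by omega)]
    have m1 : min (4 * (k + 1)) 1 = 1 := by omega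
    have m2 : min 2 1 = 1 := rfl
    have m3 : min (4 * (k + 1) - 1) 1 = 1 := by omega
    rw [m1, m2, m3]
  have c0 : G₀.deg (s.label 0) = 10 + 2 := (d0 0 (by norm_num)).trans
    (congrArg₂ _ h.deg_u (by decide +kernel))
  have c1 : G₀.deg (s.label 1) = 8 + 4 := (d0 1 (by norm_num)).trans
    (congrArg₂ _ h.deg_v (by decide +kernel))
  have c2 : G₀.deg (s.label 2) = 6 + 6 := (d0 2 (by norm_num)).trans
    (congrArg₂ _ h.deg_w (by decide +kernel))
  have c3 : G₀.deg (s.label 3) = 3 + 9 := (d0 3 (by norm_num)).trans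
    (congrArg₂ _ h.deg_x (by decide +kernel))
  have c4 : G₀.deg (s.label 4) = 3 + 7 := (e0 4 (by norm_num) (by decide)).trans
    (congrArg _ (by decide +kernel))
  have c5 : G₀.deg (s.label 5) = 3 + 5 := (e0 5 (by norm_num) (by decide)).trans
    (congrArg _ (by decide +kernel))
  have c6 : G₀.deg (s.label 6) = 3 + 3 := (e0 6 (by norm_num) (by decide)).trans
    (congrArg _ (by decide +kernel))
  have c15 : G₀.deg (s.label 15) = 3 + 0 := (e0 15 (by norm_num) (by decide)).trans
    (congrArg _ (by decide +kernel))
  have hold : ∀ i, i < 4 → ∀ j, G₃.deg (s.label i) = j →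
      ∃ y < G₃.order, y ≠ s.label 4 ∧ y ≠ s.label 5 ∧ y ≠ s.label 6 ∧ y ≠ s.label 15 ∧
        G₃.deg y = j := by
    intro i hi j hj
    have := hlt i (by omega)
    exact ⟨s.label i, by omega, hinj.ne (by omega), hinj.ne (by omega), hinj.ne (by omega),
      hinj.ne (by omega), hj⟩
  refine ⟨f3, ?_, ?_, ?_, ?_, ?_⟩
  · exact (hdeg 4 (by norm_num)).trans (by rw [c4]; simp)
  · exact (hdeg 5 (by norm_num)).trans (by rw [c5]; simp)
  · exact (hdeg 6 (by norm_num)).trans (by rw [c6]; simp)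
  · exact (hdeg 15 (by norm_num)).trans (by rw [c15]; simp)
  · intro i h3 hi h6 h8 h10
    by_cases hin : i ≤ 14 + 4 * k
    · obtain ⟨y, hy, y1, y2, y3, y4, hyd⟩ := h.deg i h3 hin h6 h8 h10
      have hne := ne_label hy y1 y2 y3 y4
      refine ⟨y, by rw [hG]; omega, hne 4, hne 5, hne 6, hne 15, ?_⟩
      rw [hG, g3 y (by omega) hne, g2 y (by omega) hne, g1 y (by omega) hne,
        g0 y hy fun i _ => hne i, hyd]
    · obtain rfl | rfl | rfl | rfl : i = 15 + 4 * k ∨ i = 16 + 4 * k ∨ i = 17 + 4 * k ∨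
          i = 18 + 4 * k := by omega
      · exact hold 2 (by norm_num) _ (by rw [hdeg 2 (by norm_num), c2]; simp; omega)
      · exact hold 1 (by norm_num) _ (by rw [hdeg 1 (by norm_num), c1]; simp; omega)
      · exact hold 3 (by norm_num) _ (by rw [hdeg 3 (by norm_num), c3]; simp; omega)
      · exact hold 0 (by norm_num) _ (by rw [hdeg 0 (by norm_num), c0]; simp; omega)

theorem isGood_coreStage (k : ℕ) : (coreStage k).IsGood (14 + 4 * k) := by
  induction k with
  | zero => exact isGood_stage14
  | succ k ih => exact ih.addPiece

end Stage

namespace Stage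

variable {s : Stage}

/-- The triangles split by `end_{1;n}`, in labels. -/
def endOneSplits : List (ℕ × ℕ × ℕ) :=
  [(1, 2, 3), (2, 3, 4), (0, 1, 3), (0, 2, 3), (1, 2, 4), (1, 3, 4), (2, 4, 5), (2, 3, 5),
    (3, 4, 5)]

/-- With `n = 17 + 4 k`, the old vertices `u, v, w` get the degrees `n, n - 1, n - 2`, and the new
marked vertices, of which one is the old `x`, the degrees `10, 8, 6, 3`. -/
theorem IsGood.addEndOne {k : ℕ} (h : s.IsGood (14 + 4 * k)) :
    (s.addEndOne (17 + 4 * k)).IsGood (17 + 4 * k) := by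
  have hρ := h.isLabelling
  have hinj := hρ.inj
  obtain ⟨hu, hv, hw, hx⟩ := h.lt
  obtain ⟨p, hp⟩ : ∃ p, p = (17 + 4 * k - 11) / 2 := ⟨_, rfl⟩
  obtain ⟨q, hq⟩ : ∃ q, q = (17 + 4 * k - 13) / 2 := ⟨_, rfl⟩
  obtain ⟨r, hr⟩ : ∃ r, r = (17 + 4 * k - 15) / 2 := ⟨_, rfl⟩
  obtain ⟨f0, d0, e0, g0⟩ := HasFaces.splitAll endOneSplits
    (L := [(0, 1, 3), (0, 2, 3), (1, 2, 3)]) h.faces hρ (by decide +kernel)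
  set G₀ := s.graph.splitAll (endOneSplits.map (relabel s.label)) with hG₀
  have o0 : G₀.order = s.graph.order + 9 := order_splitAll _ _
  have f0' := f0.mono_relabel (L' := [(0, 1, 6), (0, 2, 7), (1, 2, 8), (3, 4, 12), (3, 5, 12),
    (4, 5, 12)]) (by decide +kernel)
  obtain ⟨f1, d1, g1⟩ := HasFaces.hSplit_relabel hinj f0' (by decide) p
  set G₁ := G₀.hSplit (s.label 0) (s.label 1) (s.label 6) p with hG₁
  have o1 : G₁.order = G₀.order + p := order_hSplit _ _ _ _ _
  obtain ⟨f2, d2, g2⟩ := HasFaces.hSplit_relabel hinj f1 (by decide) q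
  set G₂ := G₁.hSplit (s.label 0) (s.label 2) (s.label 7) q with hG₂
  have o2 : G₂.order = G₁.order + q := order_hSplit _ _ _ _ _
  obtain ⟨f3, d3, g3⟩ := HasFaces.hSplit_relabel hinj f2 (by decide) r
  set G₃ := G₂.hSplit (s.label 1) (s.label 2) (s.label 8) r with hG₃
  have o3 : G₃.order = G₂.order + r := order_hSplit _ _ _ _ _
  have hG : (s.addEndOne (17 + 4 * k)).graph = G₃ := by
    rw [hG₃, hG₂, hG₁, hp, hq, hr]
    rfl
  have hlt : ∀ i < 13, s.label i < G₀.order := by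
    intro i hi
    by_cases h4 : i < 4
    · exact (hρ.lt i h4).trans (by omega)
    · obtain ⟨j, rfl⟩ := Nat.exists_eq_add_of_le (not_lt.1 h4)
      rw [hρ.new, o0]
      omega
  have hdeg : ∀ i < 13, G₃.deg (s.label i) = G₀.deg (s.label i) +
      (if i = 0 ∨ i = 1 then p else if i = 6 then min p 1 else 0) +
      (if i = 0 ∨ i = 2 then q else if i = 7 then min q 1 else 0) +
      (if i = 1 ∨ i = 2 then r else if i = 8 then min r 1 else 0) := by
    intro i hi
    have := hlt i hi
    rw [d3 i (by omega), d2 i (by omega), d1 i (by omega)]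
  have c0 : G₀.deg (s.label 0) = 10 + 2 := (d0 0 (by norm_num)).trans
    (congrArg₂ _ h.deg_u (by decide +kernel))
  have c1 : G₀.deg (s.label 1) = 8 + 4 := (d0 1 (by norm_num)).trans
    (congrArg₂ _ h.deg_v (by decide +kernel))
  have c2 : G₀.deg (s.label 2) = 6 + 6 := (d0 2 (by norm_num)).trans
    (congrArg₂ _ h.deg_w (by decide +kernel))
  have c3 : G₀.deg (s.label 3) = 3 + 7 := (d0 3 (by norm_num)).trans
    (congrArg₂ _ h.deg_x (by decide +kernel))
  have c4 : G₀.deg (s.label 4) = 3 + 5 := (e0 4 (by norm_num) (by decide)).trans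
    (congrArg _ (by decide +kernel))
  have c5 : G₀.deg (s.label 5) = 3 + 3 := (e0 5 (by norm_num) (by decide)).trans
    (congrArg _ (by decide +kernel))
  have c12 : G₀.deg (s.label 12) = 3 + 0 := (e0 12 (by norm_num) (by decide)).trans
    (congrArg _ (by decide +kernel))
  have hold : ∀ i, i < 3 → ∀ j, G₃.deg (s.label i) = j →
      ∃ y < G₃.order, y ≠ s.label 3 ∧ y ≠ s.label 4 ∧ y ≠ s.label 5 ∧ y ≠ s.label 12 ∧
        G₃.deg y = j := by
    intro i hi j hj
    have := hlt i (by omega)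
    exact ⟨s.label i, by omega, hinj.ne (by omega), hinj.ne (by omega), hinj.ne (by omega),
      hinj.ne (by omega), hj⟩
  rw [← hG] at f3 hdeg hold
  refine ⟨f3, ?_, ?_, ?_, ?_, ?_⟩
  · exact (hdeg 3 (by norm_num)).trans (by rw [c3]; simp)
  · exact (hdeg 4 (by norm_num)).trans (by rw [c4]; simp)
  · exact (hdeg 5 (by norm_num)).trans (by rw [c5]; simp)
  · exact (hdeg 12 (by norm_num)).trans (by rw [c12]; simp)
  · intro i h3 hi h6 h8 h10
    by_cases hin : i ≤ 14 + 4 * k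
    · obtain ⟨y, hy, y1, y2, y3, y4, hyd⟩ := h.deg i h3 hin h6 h8 h10
      have hne := ne_label hy y1 y2 y3 y4
      refine ⟨y, by rw [hG]; omega, hne 3, hne 4, hne 5, hne 12, ?_⟩
      rw [hG, g3 y (by omega) hne, g2 y (by omega) hne, g1 y (by omega) hne,
        g0 y hy fun i _ => hne i, hyd]
    · obtain rfl | rfl | rfl : i = 15 + 4 * k ∨ i = 16 + 4 * k ∨ i = 17 + 4 * k := by omega
      · exact hold 2 (by norm_num) _ (by rw [hdeg 2 (by norm_num), c2]; simp; omega)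
      · exact hold 1 (by norm_num) _ (by rw [hdeg 1 (by norm_num), c1]; simp; omega)
      · exact hold 0 (by norm_num) _ (by rw [hdeg 0 (by norm_num), c0]; simp; omega)

/-- The triangles split by `end_{0;n}`, in labels. -/
def endZeroSplits : List (ℕ × ℕ × ℕ) :=
  [(1, 2, 3), (0, 1, 3), (0, 2, 3), (1, 3, 4), (1, 2, 4), (2, 3, 4), (0, 1, 5), (0, 5, 10)]

/-- The vertices `u, v` get the degrees `n + 2, n + 1`, and `w, x` and a new vertex the degrees
`10, 8, 6`. -/
theorem IsGood.addEndZero {n : ℕ} (h : s.IsGood n) (hn : 12 ≤ n) :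
    (∃ L, (s.addEndZero (n + 2)).HasFaces L) ∧ ∀ i, 3 ≤ i → i ≤ n + 2 →
      ∃ v < (s.addEndZero (n + 2)).order, (s.addEndZero (n + 2)).deg v = i := by
  have hρ := h.isLabelling
  have hinj := hρ.inj
  obtain ⟨hu, hv, hw, hx⟩ := h.lt
  obtain ⟨f0, d0, e0, g0⟩ := HasFaces.splitAll endZeroSplits
    (L := [(0, 1, 3), (0, 2, 3), (1, 2, 3)]) h.faces hρ (by decide +kernel)
  set G₀ := s.graph.splitAll (endZeroSplits.map (relabel s.label)) with hG₀
  have o0 : G₀.order = s.graph.order + 8 := order_splitAll _ _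
  have f0' := f0.mono_relabel (L' := [(0, 1, 10)]) (by decide +kernel)
  obtain ⟨f1, d1, g1⟩ := HasFaces.hSplit_relabel hinj f0' (by decide) (n + 2 - 14)
  have hG : s.addEndZero (n + 2) =
    G₀.hSplit (s.label 0) (s.label 1) (s.label 10) (n + 2 - 14) := rfl
  rw [← hG] at f1 d1 g1
  have o1 : (s.addEndZero (n + 2)).order = G₀.order + (n + 2 - 14) := order_hSplit _ _ _ _ _
  have c0 : G₀.deg (s.label 0) = 10 + 4 := (d0 0 (by norm_num)).trans
    (congrArg₂ _ h.deg_u (by decide +kernel))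
  have c1 : G₀.deg (s.label 1) = 8 + 5 := (d0 1 (by norm_num)).trans
    (congrArg₂ _ h.deg_v (by decide +kernel))
  have c2 : G₀.deg (s.label 2) = 6 + 4 := (d0 2 (by norm_num)).trans
    (congrArg₂ _ h.deg_w (by decide +kernel))
  have c3 : G₀.deg (s.label 3) = 3 + 5 := (d0 3 (by norm_num)).trans
    (congrArg₂ _ h.deg_x (by decide +kernel))
  have c4 : G₀.deg (s.label 4) = 3 + 3 := (e0 4 (by norm_num) (by decide)).trans
    (congrArg _ (by decide +kernel))
  have hlt : ∀ i < 5, s.label i < G₀.order := by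
    intro i hi
    by_cases h4 : i < 4
    · exact (hρ.lt i h4).trans (by omega)
    · obtain ⟨j, rfl⟩ := Nat.exists_eq_add_of_le (not_lt.1 h4)
      rw [hρ.new, o0]
      omega
  have hmarked : ∀ i < 5, ∀ j, (G₀.deg (s.label i) + if i = 0 ∨ i = 1 then n + 2 - 14 else
      if i = 10 then min (n + 2 - 14) 1 else 0) = j →
      ∃ v < (s.addEndZero (n + 2)).order, (s.addEndZero (n + 2)).deg v = j := by
    intro i hi j hj
    have := hlt i hi
    exact ⟨s.label i, by omega, by rw [d1 i (by omega), hj]⟩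
  refine ⟨⟨_, f1⟩, fun i h3 hi => ?_⟩
  by_cases h6 : i = 6
  · exact hmarked 4 (by norm_num) _ (by rw [c4, h6]; simp)
  by_cases h8 : i = 8
  · exact hmarked 3 (by norm_num) _ (by rw [c3, h8]; simp)
  by_cases h10 : i = 10
  · exact hmarked 2 (by norm_num) _ (by rw [c2, h10]; simp)
  by_cases hin : i ≤ n
  · obtain ⟨y, hy, y1, y2, y3, y4, hyd⟩ := h.deg i h3 hin h6 h8 h10
    have hne := ne_label hy y1 y2 y3 y4
    refine ⟨y, by omega, ?_⟩
    rw [g1 y (by omega) hne, g0 y hy fun i _ => hne i, hyd]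
  · obtain rfl | rfl : i = n + 1 ∨ i = n + 2 := by omega
    · exact hmarked 1 (by norm_num) _ (by rw [c1]; simp; omega)
    · exact hmarked 0 (by norm_num) _ (by rw [c0]; simp; omega)

/-- The degrees `6, 8, 10` are those of the marked vertices `w, v, u`. -/
theorem IsGood.exists_deg {n : ℕ} (h : s.IsGood n) {i : ℕ} (h3 : 3 ≤ i) (hi : i ≤ n) :
    ∃ v < s.graph.order, s.graph.deg v = i := by
  obtain ⟨hu, hv, hw, -⟩ := h.lt
  by_cases h6 : i = 6
  · exact ⟨s.w, hw, h6 ▸ h.deg_w⟩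
  by_cases h8 : i = 8
  · exact ⟨s.v, hv, h8 ▸ h.deg_v⟩
  by_cases h10 : i = 10
  · exact ⟨s.u, hu, h10 ▸ h.deg_u⟩
  obtain ⟨y, hy, -, -, -, -, hyd⟩ := h.deg i h3 hi h6 h8 h10
  exact ⟨y, hy, hyd⟩

theorem order_addPiece (s : Stage) (k : ℕ) :
    (s.addPiece k).graph.order = s.graph.order + (12 + 4 * k + 2 + (4 * k - 1)) := by
  simp only [Stage.addPiece, order_hSplit, order_splitAll, List.length_cons, List.length_nil]
  ring

theorem order_addEndOne (s : Stage) (n : ℕ) : (s.addEndOne n).graph.order =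
    s.graph.order + (9 + (n - 11) / 2 + (n - 13) / 2 + (n - 15) / 2) := by
  simp only [Stage.addEndOne, order_hSplit, order_splitAll, List.length_cons, List.length_nil]
  ring

theorem order_addEndZero (s : Stage) (n : ℕ) :
    (s.addEndZero n).order = s.graph.order + (8 + (n - 14)) := by
  simp only [Stage.addEndZero, order_hSplit, order_splitAll, List.length_cons, List.length_nil]
  ring

end Stage

theorem order_coreStage (k : ℕ) : (coreStage k).graph.order = 26 + 17 * k + 4 * k ^ 2 := by
  induction k with
  | zero => rfl
  | succ k ih =>
    rw [coreStage, Stage.order_addPiece, ih, show 4 * (k + 1) - 1 = 4 * k + 3 by omega]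
    ring

/-- The shape of the output for the residues of `n` modulo `4`. -/
theorem algorithmOutput_cases {n : ℕ} (hn : n = 14 ∨ 16 ≤ n) : ∃ k,
    (n = 14 + 4 * k ∧ algorithmOutput n = (coreStage k).graph) ∨
    (n = 17 + 4 * k ∧ algorithmOutput n = ((coreStage k).addEndOne n).graph) ∨
    (n = 16 + 4 * k ∧ algorithmOutput n = (coreStage k).addEndZero n) ∨
    (n = 19 + 4 * k ∧
      algorithmOutput n = ((coreStage k).addEndOne (17 + 4 * k)).addEndZero n) := by
  unfold algorithmOutput
  have h4 : n % 4 = 2 ∨ n % 4 = 1 ∨ n % 4 = 0 ∨ n % 4 = 3 := by omega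
  rcases h4 with h | h | h | h
  · exact ⟨(n - 14) / 4, Or.inl ⟨by omega, by rw [if_pos h]⟩⟩
  · exact ⟨(n - 17) / 4, Or.inr (Or.inl ⟨by omega, by simp [h]⟩)⟩
  · exact ⟨(n - 16) / 4, Or.inr (Or.inr (Or.inl ⟨by omega, by simp [h]⟩))⟩
  · refine ⟨(n - 19) / 4, Or.inr (Or.inr (Or.inr ⟨by omega, ?_⟩))⟩
    have : n - 2 = 17 + 4 * ((n - 19) / 4) := by omega
    simp [h, this]

theorem algorithmOutput_spec {n : ℕ} (hn : n = 14 ∨ 16 ≤ n) :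
    (∃ L, (algorithmOutput n).HasFaces L) ∧
      (∀ i, 3 ≤ i → i ≤ n → ∃ v < (algorithmOutput n).order, (algorithmOutput n).deg v = i) ∧
      n ^ 2 + 62 ≤ 4 * (algorithmOutput n).order + 11 * n ∧
      4 * (algorithmOutput n).order + 11 * n ≤ n ^ 2 + 65 := by
  obtain ⟨k, ⟨rfl, h⟩ | ⟨rfl, h⟩ | ⟨rfl, h⟩ | ⟨rfl, h⟩⟩ := algorithmOutput_cases hn
  · rw [h, order_coreStage]
    have hg := Stage.isGood_coreStage k
    rw [← order_coreStage]
    refine ⟨⟨_, hg.faces⟩, fun i h3 hi => hg.exists_deg h3 hi, ?_⟩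
    rw [order_coreStage]
    constructor <;> nlinarith
  · rw [h]
    have hg := (Stage.isGood_coreStage k).addEndOne
    refine ⟨⟨_, hg.faces⟩, fun i h3 hi => hg.exists_deg h3 hi, ?_⟩
    rw [Stage.order_addEndOne, order_coreStage, show (17 + 4 * k - 11) / 2 = 3 + 2 * k by omega,
      show (17 + 4 * k - 13) / 2 = 2 + 2 * k by omega,
      show (17 + 4 * k - 15) / 2 = 1 + 2 * k by omega]
    constructor <;> nlinarith
  · rw [h]
    obtain ⟨h1, h2⟩ := (Stage.isGood_coreStage k).addEndZero (by omega)
    rw [show 14 + 4 * k + 2 = 16 + 4 * k by omega] at h1 h2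
    refine ⟨h1, h2, ?_⟩
    rw [Stage.order_addEndZero, order_coreStage, show 16 + 4 * k - 14 = 2 + 4 * k by omega]
    constructor <;> nlinarith
  · rw [h]
    obtain ⟨h1, h2⟩ := (Stage.isGood_coreStage k).addEndOne.addEndZero (by omega)
    rw [show 17 + 4 * k + 2 = 19 + 4 * k by omega] at h1 h2
    refine ⟨h1, h2, ?_⟩
    rw [Stage.order_addEndZero, Stage.order_addEndOne, order_coreStage,
      show 19 + 4 * k - 14 = 5 + 4 * k by omega,
      show (17 + 4 * k - 11) / 2 = 3 + 2 * k by omega,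
      show (17 + 4 * k - 13) / 2 = 2 + 2 * k by omega,
      show (17 + 4 * k - 15) / 2 = 1 + 2 * k by omega]
    constructor <;> nlinarith

/-! ### Subgraphs -/

namespace GraphData

/-- `G` is a subgraph of `H`, with the same names of the vertices. -/
structure IsSub (G H : GraphData) : Prop where
  order_le : G.order ≤ H.order
  subset : G.edges ⊆ H.edges

theorem IsSub.refl (G : GraphData) : G.IsSub G := ⟨le_rfl, fun _ h => h⟩

theorem IsSub.trans {G H K : GraphData} (h : G.IsSub H) (h' : H.IsSub K) : G.IsSub K :=
  ⟨h.order_le.trans h'.order_le, fun _ he => h'.subset (h.subset he)⟩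

theorem isSub_split (G : GraphData) (a b c : ℕ) : G.IsSub (G.split a b c) :=
  ⟨Nat.le_succ _, fun _ h => by simp [split, h]⟩

theorem isSub_splitAll (S : List (ℕ × ℕ × ℕ)) (G : GraphData) : G.IsSub (G.splitAll S) := by
  induction S generalizing G with
  | nil => exact .refl G
  | cons s S ih => exact (G.isSub_split _ _ _).trans (ih _)

theorem isSub_hSplit (a b c k : ℕ) (G : GraphData) : G.IsSub (G.hSplit a b c k) := by
  induction k generalizing G c with
  | zero => exact .refl G
  | succ k ih => exact (G.isSub_split _ _ _).trans (ih _ _)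

theorem IsSub.isContained {G H : GraphData} (h : G.IsSub H) :
    G.toGraph.IsContained H.toGraph := by
  refine ⟨⟨⟨Fin.castLE h.order_le, fun {u v} huv => ?_⟩, Fin.castLE_injective h.order_le⟩⟩
  have huv' := (fromRel_adj _ _ _).1 huv
  refine (fromRel_adj _ _ _).2 ⟨fun he => huv'.1 (Fin.castLE_injective h.order_le he), ?_⟩
  exact huv'.2.imp (fun he => h.subset he) fun he => h.subset he

end GraphData

theorem Stage.isSub_addPiece (s : Stage) (k : ℕ) : s.graph.IsSub (s.addPiece k).graph :=
  (isSub_splitAll _ _).trans (((isSub_hSplit _ _ _ _ _).trans (isSub_hSplit _ _ _ _ _)).trans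
    (isSub_hSplit _ _ _ _ _))

theorem Stage.isSub_addEndOne (s : Stage) (n : ℕ) : s.graph.IsSub (s.addEndOne n).graph :=
  (isSub_splitAll _ _).trans (((isSub_hSplit _ _ _ _ _).trans (isSub_hSplit _ _ _ _ _)).trans
    (isSub_hSplit _ _ _ _ _))

theorem Stage.isSub_addEndZero (s : Stage) (n : ℕ) : s.graph.IsSub (s.addEndZero n) :=
  (isSub_splitAll _ _).trans (isSub_hSplit _ _ _ _ _)

theorem algorithmOutput_eq_coreStage (k : ℕ) :
    algorithmOutput (14 + 4 * k) = (coreStage k).graph := by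
  unfold algorithmOutput
  rw [if_pos (by omega), show (14 + 4 * k - 14) / 4 = k by omega]

theorem extremalGraph_isContained {n m : ℕ} (h : (algorithmOutput m).IsSub (algorithmOutput n)) :
    (extremalGraph m).IsContained (extremalGraph n) := h.isContained

/-! ### The extremal graphs -/

theorem propertyP_extremalGraph {n : ℕ} (hn : n = 14 ∨ 16 ≤ n) :
    PropertyP n (extremalGraph n) := by
  obtain ⟨⟨L, hL⟩, hdeg, -, hle⟩ := algorithmOutput_spec hn
  refine ⟨hL.isPolytopal, hL.hasDegreesUpTo hdeg, fun q hq => ?_⟩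
  have := le_of_mem_polytopalOrders hq (by omega)
  rw [Nat.card_eq_fintype_card, Fintype.card_fin]
  omega

theorem ceil_eq {n p : ℕ} (hp : p ≠ 0) (h₁ : n ^ 2 + 62 ≤ 4 * p + 11 * n)
    (h₂ : 4 * p + 11 * n ≤ n ^ 2 + 65) :
    ⌈((n : ℚ) ^ 2 - 11 * (n : ℚ) + 62) / 4⌉₊ = p := by
  have h₁' : (n : ℚ) ^ 2 + 62 ≤ 4 * p + 11 * n := by exact_mod_cast h₁
  have h₂' : 4 * (p : ℚ) + 11 * n ≤ n ^ 2 + 65 := by exact_mod_cast h₂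
  rw [Nat.ceil_eq_iff hp, Nat.cast_sub (Nat.one_le_iff_ne_zero.2 hp), Nat.cast_one]
  constructor
  · rw [lt_div_iff₀ (by norm_num)]
    linarith
  · rw [div_le_iff₀ (by norm_num)]
    linarith

theorem isLeast_polytopalOrders {n : ℕ} (hn : 14 ≤ n) :
    IsLeast (polytopalOrders n) ⌈((n : ℚ) ^ 2 - 11 * (n : ℚ) + 62) / 4⌉₊ := by
  obtain ⟨p, hp, h₁, h₂⟩ : ∃ p ∈ polytopalOrders n, n ^ 2 + 62 ≤ 4 * p + 11 * n ∧
      4 * p + 11 * n ≤ n ^ 2 + 65 := by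
    by_cases h15 : n = 15
    · subst h15
      exact ⟨31, thirtyone_mem_polytopalOrders, by norm_num, by norm_num⟩
    · obtain ⟨⟨L, hL⟩, hdeg, h₁, h₂⟩ := algorithmOutput_spec (n := n) (by omega)
      exact ⟨_, hL.order_mem_polytopalOrders hdeg, h₁, h₂⟩
  have hle := succ_le_of_mem_polytopalOrders hp (by omega)
  rw [ceil_eq (by omega) h₁ h₂]
  refine ⟨hp, fun q hq => ?_⟩
  have := le_of_mem_polytopalOrders hq hn
  omega

theorem theorem1 :
    -- the least order for small `n`
    (∀ n : ℕ, 3 ≤ n → n ≤ 7 → IsLeast (polytopalOrders n) (n + 1)) ∧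
    IsLeast (polytopalOrders 8) 10 ∧
    IsLeast (polytopalOrders 9) 11 ∧
    IsLeast (polytopalOrders 10) 14 ∧
    IsLeast (polytopalOrders 11) 16 ∧
    IsLeast (polytopalOrders 12) 19 ∧
    IsLeast (polytopalOrders 13) 23 ∧
    -- the least order for large `n`
    (∀ n : ℕ, 14 ≤ n →
      IsLeast (polytopalOrders n) ⌈((n : ℚ) ^ 2 - 11 * (n : ℚ) + 62) / 4⌉₊) ∧
    -- the algorithm constructs extremal graphs
    PropertyP 14 (extremalGraph 14) ∧
    (∀ n : ℕ, 16 ≤ n → PropertyP n (extremalGraph n)) ∧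
    -- each contains an earlier one as a subgraph, up to isomorphism
    (∀ n : ℕ, 16 ≤ n →
      (n % 4 = 0 → (extremalGraph (n - 2)).IsContained (extremalGraph n)) ∧
      (n % 4 = 1 → (extremalGraph (n - 3)).IsContained (extremalGraph n)) ∧
      (n % 4 = 2 → (extremalGraph (n - 4)).IsContained (extremalGraph n)) ∧
      (n % 4 = 3 → (extremalGraph (n - 5)).IsContained (extremalGraph n))) := by
  have hedges : ∀ {n p q : ℕ}, q ∈ polytopalOrders n →
      3 * p < ∑ i ∈ Finset.Icc 3 n, (i - 3) + 15 → p ≤ q := by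
    intro n p q hq h
    have := sum_sub_three_add_twelve_le hq
    omega
  refine ⟨?_, ⟨ten_mem_polytopalOrders, fun q hq => ?_⟩,
    ⟨eleven_mem_polytopalOrders, fun q hq => hedges hq (by decide)⟩,
    ⟨fourteen_mem_polytopalOrders, fun q hq => hedges hq (by decide)⟩,
    ⟨sixteen_mem_polytopalOrders, fun q hq => hedges hq (by decide)⟩,
    ⟨nineteen_mem_polytopalOrders, fun q hq => hedges hq (by decide)⟩,
    ⟨twentythree_mem_polytopalOrders, fun q hq => hedges hq (by decide)⟩,
    fun n hn => isLeast_polytopalOrders hn, propertyP_extremalGraph (Or.inl rfl),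
    fun n hn => propertyP_extremalGraph (Or.inr hn), ?_⟩
  · intro n h3 h7
    refine ⟨?_, fun q hq => succ_le_of_mem_polytopalOrders hq h3⟩
    obtain rfl | rfl | rfl | rfl | rfl : n = 3 ∨ n = 4 ∨ n = 5 ∨ n = 6 ∨ n = 7 := by omega
    · exact four_mem_polytopalOrders
    · exact five_mem_polytopalOrders
    · exact six_mem_polytopalOrders
    · exact seven_mem_polytopalOrders
    · exact eight_mem_polytopalOrders
  · -- Here the vertices of degrees `6, 7, 8` give more than the number of edges.
    have h := sum_Icc_add_sixteen_le hq (a := 6) (by norm_num) (by norm_num)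
    have h' : ∑ i ∈ Finset.Icc 6 8, i = 21 := by decide
    omega
  · intro n hn
    obtain ⟨k, ⟨rfl, h⟩ | ⟨rfl, h⟩ | ⟨rfl, h⟩ | ⟨rfl, h⟩⟩ :=
      algorithmOutput_cases (n := n) (Or.inr hn)
    · refine ⟨fun h => by omega, fun h => by omega, fun _ => ?_, fun h => by omega⟩
      obtain ⟨k, rfl⟩ : ∃ l, k = l + 1 := ⟨k - 1, by omega⟩
      refine extremalGraph_isContained ?_
      rw [h, show 14 + 4 * (k + 1) - 4 = 14 + 4 * k by omega, algorithmOutput_eq_coreStage]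
      exact Stage.isSub_addPiece _ _
    · refine ⟨fun h => by omega, fun _ => ?_, fun h => by omega, fun h => by omega⟩
      refine extremalGraph_isContained ?_
      rw [h, show 17 + 4 * k - 3 = 14 + 4 * k by omega, algorithmOutput_eq_coreStage]
      exact Stage.isSub_addEndOne _ _
    · refine ⟨fun _ => ?_, fun h => by omega, fun h => by omega, fun h => by omega⟩
      refine extremalGraph_isContained ?_
      rw [h, show 16 + 4 * k - 2 = 14 + 4 * k by omega, algorithmOutput_eq_coreStage]
      exact Stage.isSub_addEndZero _ _
    · refine ⟨fun h => by omega, fun h => by omega, fun h => by omega, fun _ => ?_⟩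
      refine extremalGraph_isContained ?_
      rw [h, show 19 + 4 * k - 5 = 14 + 4 * k by omega, algorithmOutput_eq_coreStage]
      exact (Stage.isSub_addEndOne _ _).trans (Stage.isSub_addEndZero _ _)
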